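/- Let $n\ge 3$, let $\kappa>0$ and $\gamma\in\mathbb R$ with $\gamma^2>0$, and let $A:\mathbb S^{n-1}\to\mathbb R^{n\times n}$ be real-analytic with $A(\eta)$ symmetric and positive definite for every $\eta$. Let $\mathcal U\subset\mathbb S^{n-1}$ be an open set such that for every $\eta\in\mathcal U$ the matrix $A(\eta)$ has $n$ distinct eigenvalues $0<\varkappa_1(\eta)<\dots<\varkappa_n(\eta)$, and let $r_1,\dots,r_n\in C^\infty(\mathcal U,\mathbb S^{n-1})$ be corresponding normalised eigenvectors (such a choice exists for instance if $\mathcal U$ is simply connected). For $\xi\neq0$ with $\eta=\xi/|\xi|\in\mathcal U$ put $\omega_j(\xi)=|\xi|\sqrt{\varkappa_j(\eta)}$, $a_j(\xi)=r_j(\eta)\cdot\xi$, and let $B(\xi)\in\mathbb C^{(2n+1)\times(2n+1)}$ be the symbol of the thermo-elastic system, which acts on $(v^+,v^-,\vartheta)\in\mathbb C^n\times\mathbb C^n\times\mathbb C$ by $$ v_j^\pm\mapsto \pm\omega_j(\xi)v_j^\pm+\mathrm i\gamma a_j(\xi)\vartheta,\qquad \vartheta\mapsto-\tfrac{\mathrm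 i\gamma}{2}\sum_{j=1}^n a_j(\xi)\,(v_j^++v_j^-)+\mathrm i\kappa|\xi|^2\vartheta . $$ A direction $\eta\in\mathcal U$ is called parabolic if $r_j(\eta)\cdot\eta\ne0$ for all $j=1,\dots,n$. Let $\psi,\tilde\psi\in C^\infty(\mathbb S^{n-1})$ be supported in $\mathcal U$ with $\tilde\psi=1$ on $\operatorname{supp}\psi$, extended to $\mathbb R^n$ as $0$-homogeneous functions, and assume that $\operatorname{supp}\psi$ is contained in the set of parabolic directions. Let $\epsilon>0$ and let $\chi$ be a smooth real function with $\chi(s)=0$ for $s\le\epsilon$ and $\chi(s)=1$ for $s\ge2\epsilon$. Write $\mathrm D=-\mathrm i\nabla$, $\mathrm D_t=-\mathrm i\partial_t$, let $m(\mathrm D)$ be the Fourier multiplier with symbol $m(\xi)$, and let $\|f\|_{p,s}=\|(1+|\mathrm D|^2)^{s/2}f\|_p$. Then there is $C>0$ such that for all $1\le p\le2\le q\le\infty$ the following holds for all $V_0\in\mathcal S(\mathbb R^n;\mathbb C^{2n+1})$, all $t\ge0$, and all solutions $V$, with $V(t,\cdot)\in L^2(\mathbb R^n;\mathbb C^{2n+1})$,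 of $$\mathrm D_tV=B(\mathrm D)V,\qquad V(0,\cdot)=\tilde\psi(\mathrm D)V_0,$$ understood as the ordinary differential equation in $t\ge 0$ for the partial Fourier transform of $V$ at almost every $\xi$, with $\hat V(t,\xi)=0$ for $\xi/|\xi|\notin\operatorname{supp}\tilde\psi$: $$\|\chi(|\mathrm D|)\psi(\mathrm D)V(t,\cdot)\|_q\le K\,\mathrm e^{-Ct}\,\|V_0\|_{p,s}\qquad\text{for every real } s>n\left(\tfrac1p-\tfrac1q\right),$$ $$\|(1-\chi(|\mathrm D|))\psi(\mathrm D)V(t,\cdot)\|_q\le K'\,(1+t)^{-\frac n2\left(\frac1p-\frac1q\right)}\,\|V_0\|_p .$$ The constants $K$ (depending on $p,q,s$) and $K'$ (depending on $p,q$) do not depend on $t$, $V_0$, $V$. -/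

import Mathlib

open MeasureTheory Metric
open scoped ENNReal ContDiff Manifold SchwartzMap FourierTransform

noncomputable section

namespace ThermoElastic

/-- `ℝⁿ` with the Euclidean norm. -/
abbrev Space (n : ℕ) : Type := EuclideanSpace ℝ (Fin n)

/-- The unit sphere `𝕊ⁿ⁻¹`. -/
abbrev Sph (n : ℕ) : Type := sphere (0 : Space n) 1

/-- Index set of the `2n+1` components: the groups `+`, `-`, and the temperature. -/
abbrev Idx (n : ℕ) : Type := (Fin n ⊕ Fin n) ⊕ Unit

/-- `ℂ²ⁿ⁺¹` with the Euclidean norm. -/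
abbrev State (n : ℕ) : Type := EuclideanSpace ℂ (Idx n)

/-- Makes Mathlib's analytic manifold structure on `𝕊ⁿ⁻¹`, modelled on `ℝⁿ⁻¹`, available. -/
instance finrankFact (n : ℕ) [h : Fact (3 ≤ n)] :
    Fact (Module.finrank ℝ (Space n) = (n - 1) + 1) :=
  ⟨by have := h.out; rw [finrank_euclideanSpace_fin]; omega⟩

/-- The elastic operator: a real-analytic function `η ↦ A(η)` on the sphere with values in the
symmetric positive definite real matrices (`Matrix.PosDef` includes symmetry).  Its symbol on
`ℝⁿ` is the 2-homogeneous extension `A(ξ) = |ξ|² A(ξ/|ξ|)`. -/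
structure ElasticSymbol (n : ℕ) [Fact (3 ≤ n)] where
  toFun : Sph n → Matrix (Fin n) (Fin n) ℝ
  analytic : ∀ i j, ContMDiff (𝓡 (n - 1)) 𝓘(ℝ, ℝ) ω (fun η => toFun η i j)
  posDef : ∀ η, (toFun η).PosDef

/-- `L²(ℝⁿ; ℂ²ⁿ⁺¹)`. -/
abbrev L2 (n : ℕ) : Type := Lp (State n) 2 (volume : Measure (Space n))

section Directions

variable {n : ℕ} [Fact (3 ≤ n)] (A : ElasticSymbol n)

/-- `η` is (elastically) non-degenerate: `A(η)` has `n` distinct eigenvalues. -/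
def IsNondegenerate (η : Sph n) : Prop :=
  (spectrum ℝ (A.toFun η)).ncard = n

/-- The eigenvalues `ϰ₁(η) ≤ ⋯ ≤ ϰₙ(η)` of `A(η)` in ascending order
(`eigenvalues₀` lists them in descending order). -/
def eigenvalue (j : Fin n) (η : Sph n) : ℝ :=
  (A.posDef η).isHermitian.eigenvalues₀ (Fin.cast (Fintype.card_fin n).symm j.rev)

/-- `r₁, …, rₙ` is a smooth choice on `𝓤` of normalised eigenvectors of `A(η)` associated
to `ϰ₁(η), …, ϰₙ(η)`. -/
structure IsEigenframe (U : Set (Sph n)) (r : Fin n → Sph n → Space n) : Prop where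
  smooth : ∀ j, ContMDiffOn (𝓡 (n - 1)) 𝓘(ℝ, Space n) ∞ (r j) U
  norm_eq_one : ∀ j, ∀ η ∈ U, ‖r j η‖ = 1
  eigen : ∀ j, ∀ η ∈ U,
    Matrix.toEuclideanLin (A.toFun η) (r j η) = eigenvalue A j η • r j η

/-- `η` is parabolic: it is non-degenerate and no coupling function `aⱼ(η) = rⱼ(η) · η`
vanishes. -/
def IsParabolic (r : Fin n → Sph n → Space n) (η : Sph n) : Prop :=
  IsNondegenerate A η ∧ ∀ j, inner ℝ (r j η) (η : Space n) ≠ 0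

end Directions

section Symbols

variable {n : ℕ}

/-- The direction `η = ξ/|ξ|` of a nonzero frequency. -/
def direction (ξ : Space n) (h : ξ ≠ 0) : Sph n :=
  ⟨‖ξ‖⁻¹ • ξ, by
    rw [mem_sphere_zero_iff_norm, norm_smul, norm_inv, norm_norm,
      inv_mul_cancel₀ (norm_ne_zero_iff.mpr h)]⟩

/-- The open cone `{ξ ≠ 0 | ξ/|ξ| ∈ S}` over a set of directions. -/
def cone (S : Set (Sph n)) : Set (Space n) :=
  {ξ | ∃ h : ξ ≠ 0, direction ξ h ∈ S}

open Classical in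
/-- The 0-homogeneous extension to `ℝⁿ` of a function on the sphere (with the irrelevant value
`0` at the origin). -/
def homExt (ψ : Sph n → ℂ) (ξ : Space n) : ℂ :=
  if h : ξ ≠ 0 then ψ (direction ξ h) else 0

variable [Fact (3 ≤ n)]

/-- `ωⱼ(ξ) = √ϰⱼ(ξ) = |ξ| √ϰⱼ(η)` for `ξ = |ξ| η`. -/
def omega (A : ElasticSymbol n) (j : Fin n) (ξ : Space n) (h : ξ ≠ 0) : ℝ :=
  ‖ξ‖ * √(eigenvalue A j (direction ξ h))

/-- The coupling function `aⱼ(ξ) = rⱼ(η) · ξ`. -/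
def coupling (r : Fin n → Sph n → Space n) (j : Fin n) (ξ : Space n) (h : ξ ≠ 0) : ℝ :=
  inner ℝ (r j (direction ξ h)) ξ

/-- The coefficient matrix `B(ξ)` of the first order system `D_t V̂ = B(ξ) V̂`, `D_t = -i ∂_t`,
for `ξ ≠ 0`:
`V⁺ⱼ ↦ ωⱼ V⁺ⱼ + iγ aⱼ θ`, `V⁻ⱼ ↦ -ωⱼ V⁻ⱼ + iγ aⱼ θ`,
`θ ↦ -(iγ/2) ∑ⱼ aⱼ (V⁺ⱼ + V⁻ⱼ) + iκ|ξ|² θ`. -/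
def symbolB (A : ElasticSymbol n) (κ γ : ℝ) (r : Fin n → Sph n → Space n)
    (ξ : Space n) (h : ξ ≠ 0) : Matrix (Idx n) (Idx n) ℂ :=
  Matrix.fromBlocks
    (Matrix.fromBlocks
      (Matrix.diagonal fun j => (omega A j ξ h : ℂ)) 0
      0 (Matrix.diagonal fun j => -(omega A j ξ h : ℂ)))
    (Matrix.of fun i _ => Complex.I * γ * coupling r (Sum.elim id id i) ξ h)
    (Matrix.of fun _ i => -(Complex.I * γ / 2) * coupling r (Sum.elim id id i) ξ h)
    (Matrix.of fun _ _ => Complex.I * κ * (‖ξ‖ ^ 2 : ℝ))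

end Symbols

section Multipliers

variable {n : ℕ}

open Classical in
/-- The Fourier multiplier `m(D)`, `D = -i∂`, on `L²(ℝⁿ; ℂ²ⁿ⁺¹)`.  Mathlib's Fourier transform
has kernel `exp(-2πi x·k)`, so the frequency is `ξ = 2πk`.  (For `m` not mapping `f` into `L²` the
value is `0`; this does not occur for bounded measurable `m`, see `fourier_multiplier`.) -/
def multiplier (m : Space n → ℂ) (f : L2 n) : L2 n :=
  if h : MemLp (fun k => m ((2 * Real.pi) • k) • (𝓕 f : L2 n) k) 2
      (volume : Measure (Space n)) then 𝓕⁻ (h.toLp _ : L2 n) else 0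

theorem fourier_multiplier {m : Space n → ℂ} (hm : Measurable m) {C : ℝ} (hC : ∀ ξ, ‖m ξ‖ ≤ C)
    (f : L2 n) :
    (𝓕 (multiplier m f) : L2 n) =ᵐ[volume] fun k => m ((2 * Real.pi) • k) • (𝓕 f : L2 n) k := by
  have h : MemLp (fun k => m ((2 * Real.pi) • k) • (𝓕 f : L2 n) k) 2
      (volume : Measure (Space n)) := by
    refine MemLp.of_le_mul (c := C) (Lp.memLp (𝓕 f : L2 n)) ?_ ?_
    · exact (hm.comp (measurable_const_smul _)).aestronglyMeasurable.smul
        (Lp.aestronglyMeasurable _)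
    · filter_upwards with k
      rw [norm_smul]
      exact mul_le_mul_of_nonneg_right (hC _) (norm_nonneg _)
  rw [multiplier, dif_pos h, FourierTransform.fourier_fourierInv_eq]
  exact h.coeFn_toLp

/-- The Sobolev (Bessel potential) norm `‖f‖_{p,r} = ‖(1 + |D|²)^{r/2} f‖_p`. -/
def sobolevNorm (p : ℝ≥0∞) (r : ℝ) (f : 𝓢(Space n, State n)) : ℝ≥0∞ :=
  eLpNorm (SchwartzMap.fourierMultiplierCLM (State n)
    (fun k : Space n => (((1 + ‖(2 * Real.pi) • k‖ ^ 2) ^ (r / 2) : ℝ) : ℂ)) f) p volume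

variable [Fact (3 ≤ n)]

/-- `V(t)`, `t ≥ 0`, solves `D_t V = B(D) V`, `V(0) = ψ'(D) V₀`.  The equation is the ordinary
differential equation `∂_t W(t,ξ) = i B(ξ) W(t,ξ)` for the partial Fourier transform `W` of `V`;
`B(ξ)` is only used on the cone over `supp ψ'`, outside of which `W` vanishes. -/
def IsSolution (A : ElasticSymbol n) (κ γ : ℝ) (r : Fin n → Sph n → Space n)
    (ψ' : Sph n → ℂ) (V₀ : 𝓢(Space n, State n))
    (V : ℝ → L2 n) : Prop :=
  V 0 = multiplier (homExt ψ') (V₀.toLp 2) ∧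
  ∃ W : ℝ → Space n → State n,
    (∀ t, 0 ≤ t → ∀ᵐ ξ, W t ξ = (𝓕 (V t) : L2 n) ((2 * Real.pi)⁻¹ • ξ)) ∧
    (∀ᵐ ξ, ξ ∉ cone (tsupport ψ') → ∀ t, 0 ≤ t → W t ξ = 0) ∧
    (∀ᵐ ξ, ∀ h : ξ ≠ 0, direction ξ h ∈ tsupport ψ' → ∀ t, 0 ≤ t →
      HasDerivWithinAt (fun s => W s ξ)
        (Complex.I • Matrix.toEuclideanLin (symbolB A κ γ r ξ h) (W t ξ)) (Set.Ici 0) t)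

end Multipliers

end ThermoElastic

end

/-! Everything reduces to one pointwise bound: over the compact set `tsupport ψ` of parabolic
directions, solutions of the frequency-wise ODE satisfy `|V̂(t,ξ)| ≤ 3 exp(-c min(1,|ξ|²) t)
|V̂₀(ξ)|` with a uniform `c > 0`.

The bound comes from a corrected energy instead of eigenvalue expansions of `B(ξ)`. With `ρ = |ξ|`,
the `2n` elastic modes `u_k` have frequencies `ρ μ_k`, `μ_k = ±√ϰ_j`, and couple to the temperature
`θ` through `ρ α_k`, `α_k = r_j · η`. The energy `∑|u_k|² + 2|θ|²` dissipates only `|θ|²`.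
Differentiating `∑ α_k ū_k θ` produces `|∑ α_k u_k|²`, which controls only one combination of the
modes. Since the `μ_k` are pairwise distinct, the cross terms `ū_k u_l` with `k ≠ l` oscillate and
are removed by a quadratic normal-form term with coefficients `α_k α_l / (i(μ_l - μ_k))`. What
remains is `∑ α_k² |u_k|²`, coercive because no `α_k` vanishes, plus terms containing `θ`, which the
heat dissipation absorbs (`corrector_deriv_identity`, `dissipation_le`, `exists_energy_decay`).
Compactness makes the gap and the couplings uniform (`exists_uniform_constants`).

The `L^p`–`L^q` part uses only sizes of symbols: Hausdorff–Young, Hölder and Hausdorff–Young again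
bound a multiplier by the `L^r` norm of a majorant, `1/r = 1/p - 1/q`
(`exists_eLpNorm_fourierInv_le`). For high frequencies the majorant is `exp(-ct)` times a Bessel
weight, which lies in `L^r` when `s > n(1/p - 1/q)`. For low frequencies it is a Gaussian in
`(1+t)|ξ|²`, whose `L^r` norm gives the polynomial rate by scaling. -/

noncomputable section

namespace ThermoElastic

/-! ### The `L²` Fourier transform: sup bound and reflection. -/

section FourierSupBound

variable {E F : Type*} [NormedAddCommGroup E] [MeasurableSpace E] [BorelSpace E]
  [NormedAddCommGroup F] [InnerProductSpace ℂ F] [CompleteSpace F]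
  [InnerProductSpace ℝ E] [FiniteDimensional ℝ E]

/-- On `L¹ ∩ L²` the `L²` Fourier transform is given by the Fourier integral. -/
theorem coeFn_fourier_ae_eq (f : Lp F 2 (volume : Measure E)) (hf : Integrable f (volume : Measure E)) :
    (𝓕 f : Lp F 2 (volume : Measure E)) =ᵐ[volume] 𝓕 (f : E → F) := by
  have hcont : Continuous (𝓕 (f : E → F)) :=
    VectorFourier.fourierIntegral_continuous Real.continuous_fourierChar
      (by exact continuous_inner) hf
  refine ae_eq_of_integral_contDiff_smul_eq
    ((Lp.memLp (𝓕 f : Lp F 2 (volume : Measure E))).locallyIntegrable one_le_two) hcont.locallyIntegrable ?_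
  intro g g_smooth g_cpt
  have hg₁ : HasCompactSupport (Complex.ofRealCLM ∘ g) := g_cpt.comp_left rfl
  have hg₂ : ContDiff ℝ ∞ (Complex.ofRealCLM ∘ g) := by fun_prop
  let φ : 𝓢(E, ℂ) := hg₁.toSchwartzMap hg₂
  have h1 := congrArg (fun T => T φ) (Lp.fourier_toTemperedDistribution_eq f)
  simp only [TemperedDistribution.fourier_apply, Lp.toTemperedDistribution_apply] at h1
  have h2 : ∫ x, (𝓕 (φ : E → ℂ)) x • f x = ∫ x, φ x • (𝓕 (f : E → F)) x := by
    simpa using! VectorFourier.integral_fourierIntegral_smul_eq_flip (L := innerₗ E)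
      Real.continuous_fourierChar continuous_inner φ.integrable hf
  rw [SchwartzMap.fourier_coe, h2] at h1
  simpa [φ] using h1.symm

theorem eLpNorm_fourier_top_le (f : Lp F 2 (volume : Measure E)) :
    eLpNorm (𝓕 f : Lp F 2 (volume : Measure E)) ∞ volume ≤ eLpNorm f 1 volume := by
  by_cases hf : Integrable f (volume : Measure E)
  · rw [eLpNorm_congr_ae (coeFn_fourier_ae_eq f hf), eLpNorm_exponent_top]
    refine eLpNormEssSup_le_of_ae_enorm_bound (ae_of_all _ fun x => ?_)
    have h := VectorFourier.norm_fourierIntegral_le_integral_norm Real.fourierChar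
      (volume : Measure E) (innerₗ E) f x
    rw [eLpNorm_one_eq_lintegral_enorm, ← ofReal_integral_norm_eq_lintegral_enorm hf,
      ← ofReal_norm]
    exact ENNReal.ofReal_le_ofReal h
  · have : eLpNorm f 1 (volume : Measure E) = ⊤ := by
      by_contra h
      exact hf (memLp_one_iff_integrable.1 ⟨Lp.aestronglyMeasurable f, lt_top_iff_ne_top.2 h⟩)
    simp [this]

/-- Both sides are continuous in `f` on `L²` and agree on the dense Schwartz functions. Reflection
preserves measure, so Hausdorff–Young for `𝓕` transfers to `𝓕⁻`. -/
theorem fourierInv_ae_eq_fourier_comp_neg (f : Lp F 2 (volume : Measure E)) :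
    (𝓕⁻ f : Lp F 2 (volume : Measure E)) =ᵐ[volume] fun x => (𝓕 f : Lp F 2 (volume : Measure E)) (-x) := by
  let N : Lp F 2 (volume : Measure E) → Lp F 2 (volume : Measure E) :=
    Lp.compMeasurePreserving (fun x : E => -x) (Measure.measurePreserving_neg volume)
  have hN : Continuous N := (Lp.isometry_compMeasurePreserving _).continuous
  have key : (𝓕⁻ f : Lp F 2 (volume : Measure E)) = N (𝓕 f) := by
    refine DenseRange.induction_on
      (p := fun f : Lp F 2 (volume : Measure E) => (𝓕⁻ f : Lp F 2 (volume : Measure E)) = N (𝓕 f))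
      (SchwartzMap.denseRange_toLpCLM (p := 2) ENNReal.ofNat_ne_top) f
      (isClosed_eq (FourierTransform.continuous_fourierInv)
        (hN.comp FourierTransform.continuous_fourier)) ?_
    intro g
    simp only [SchwartzMap.toLpCLM_apply, SchwartzMap.toLp_fourierInv_eq,
      SchwartzMap.toLp_fourier_eq]
    apply Lp.ext
    have h1 := (𝓕 g).coeFn_toLp 2 (volume : Measure E)
    filter_upwards [(𝓕⁻ g).coeFn_toLp 2 (volume : Measure E),
      Lp.coeFn_compMeasurePreserving ((𝓕 g).toLp 2 (volume : Measure E))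
        (Measure.measurePreserving_neg volume),
      (Measure.measurePreserving_neg (volume : Measure E)).quasiMeasurePreserving.ae h1]
      with x hx1 hx2 hx3
    rw [hx1, hx2, Function.comp_apply, hx3, SchwartzMap.fourier_coe, SchwartzMap.fourierInv_coe,
      Real.fourierInv_eq_fourier_neg]
  rw [key]
  exact Lp.coeFn_compMeasurePreserving _ _

theorem eLpNorm_fourierInv (f : Lp F 2 (volume : Measure E)) (q : ℝ≥0∞) :
    eLpNorm (𝓕⁻ f : Lp F 2 (volume : Measure E)) q volume = eLpNorm (𝓕 f : Lp F 2 (volume : Measure E)) q volume := by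
  rw [eLpNorm_congr_ae (fourierInv_ae_eq_fourier_comp_neg f)]
  exact eLpNorm_comp_measurePreserving (Lp.aestronglyMeasurable _)
    (Measure.measurePreserving_neg volume)

end FourierSupBound

/-! ### Real interpolation between `L² → L²` and `L¹ → L^∞`. -/

section Interpolation

variable {α F : Type*} [MeasurableSpace α] {μ : Measure α} [NormedAddCommGroup F]

/-- Truncating an `L²` function at height `h` and using the `L¹ → L^∞` bound on the high part
bounds the distribution function of the image by the energy of the low part. -/
theorem meas_lt_norm_le_of_split {β : Type*} [MeasurableSpace β] {ν : Measure β}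
    (T : Lp F 2 μ → Lp F 2 ν) (hadd : ∀ f g, T (f + g) = T f + T g)
    (hiso : ∀ f, ‖T f‖ = ‖f‖)
    (hsup : ∀ f, eLpNorm (T f) ⊤ ν ≤ eLpNorm f 1 μ) {p : ℝ} (hp : 1 < p) (f : Lp F 2 μ)
    (hfp : Integrable (fun x => ‖f x‖ ^ p) μ) {t h : ℝ} (ht : 0 < t) (hh : 0 < h)
    (hth : h ^ (1 - p) * ∫ x, ‖f x‖ ^ p ∂μ ≤ t / 2) :
    ν {y | t < ‖T f y‖} ≤
      ∫⁻ x, ENNReal.ofReal (4 / t ^ 2 * (if ‖f x‖ ≤ h then ‖f x‖ ^ 2 else 0)) ∂μ := by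
  have hfm : StronglyMeasurable f := Lp.stronglyMeasurable f
  have hs : MeasurableSet {x | ‖f x‖ ≤ h} := measurableSet_le hfm.norm.measurable measurable_const
  have m2 : MemLp ({x | ‖f x‖ ≤ h}.indicator f) 2 μ := (Lp.memLp f).indicator hs
  have m1 : MemLp ({x | ‖f x‖ ≤ h}ᶜ.indicator f) 2 μ := (Lp.memLp f).indicator hs.compl
  have hsum : f = m1.toLp _ + m2.toLp _ := by
    apply Lp.ext
    filter_upwards [Lp.coeFn_add (m1.toLp _) (m2.toLp _), m1.coeFn_toLp, m2.coeFn_toLp]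
      with x h0 h1 h2
    rw [h0, Pi.add_apply, h1, h2, ← Pi.add_apply, Set.indicator_compl_add_self]
  -- Where `‖f‖ > h`, `p > 1` gives `‖f‖ ≤ h^(1-p) ‖f‖^p`; the high part thus has `L¹` norm at most
  -- `t/2`, and its image stays below `t/2`.
  have hhigh : ∀ᵐ y ∂ν, ‖T (m1.toLp _) y‖ ≤ t / 2 := by
    have hb : eLpNorm (T (m1.toLp _)) ⊤ ν ≤ ENNReal.ofReal (t / 2) := by
      refine (hsup _).trans ?_
      rw [eLpNorm_congr_ae m1.coeFn_toLp, eLpNorm_one_eq_lintegral_enorm]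
      calc ∫⁻ x, ‖({x | ‖f x‖ ≤ h}ᶜ.indicator f) x‖ₑ ∂μ
          ≤ ∫⁻ x, ENNReal.ofReal (h ^ (1 - p) * ‖f x‖ ^ p) ∂μ := by
            refine lintegral_mono fun x => ?_
            by_cases hx : ‖f x‖ ≤ h
            · simp [hx]
            · push Not at hx
              rw [Set.indicator_of_mem (by simpa using hx), ← ofReal_norm]
              refine ENNReal.ofReal_le_ofReal ?_
              have hfx : 0 < ‖f x‖ := hh.trans hx
              calc ‖f x‖ = ‖f x‖ ^ (1 - p) * ‖f x‖ ^ p := by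
                    rw [← Real.rpow_add hfx]; simp
                _ ≤ h ^ (1 - p) * ‖f x‖ ^ p := by
                    gcongr ?_ * _
                    exact Real.rpow_le_rpow_of_nonpos hh hx.le (by linarith)
        _ = ENNReal.ofReal (h ^ (1 - p) * ∫ x, ‖f x‖ ^ p ∂μ) := by
            rw [← integral_const_mul, ofReal_integral_eq_lintegral_ofReal (hfp.const_mul _)
              (ae_of_all _ fun x => by positivity)]
        _ ≤ _ := ENNReal.ofReal_le_ofReal hth
    rw [eLpNorm_exponent_top] at hb
    filter_upwards [enorm_ae_le_eLpNormEssSup (T (m1.toLp _)) ν] with y hy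
    have := hy.trans hb
    rw [← ofReal_norm] at this
    exact (ENNReal.ofReal_le_ofReal_iff (by positivity)).1 this
  have hsub : ν {y | t < ‖T f y‖} ≤ ν {y | ENNReal.ofReal (t / 2) ≤ ‖T (m2.toLp _) y‖ₑ} := by
    refine measure_mono_ae ?_
    have hT : T f = T (m1.toLp _) + T (m2.toLp _) := by rw [← hadd, ← hsum]
    filter_upwards [hhigh, Lp.coeFn_add (T (m1.toLp _)) (T (m2.toLp _))] with y h1 h2 hy
    have hy' : t < ‖T f y‖ := hy
    rw [hT, h2, Pi.add_apply] at hy'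
    have := norm_add_le (T (m1.toLp _) y) (T (m2.toLp _) y)
    change ENNReal.ofReal (t / 2) ≤ ‖T (m2.toLp _) y‖ₑ
    rw [← ofReal_norm]
    exact ENNReal.ofReal_le_ofReal (by linarith)
  -- The low part must account for the remaining `t/2`: Chebyshev in `L²`, then the isometry.
  have hcheb := mul_meas_ge_le_pow_eLpNorm' ν (p := 2) (by norm_num) (by norm_num)
    (Lp.aestronglyMeasurable (T (m2.toLp _))) (ENNReal.ofReal (t / 2))
  have hE : eLpNorm (T (m2.toLp _)) 2 ν = eLpNorm ({x | ‖f x‖ ≤ h}.indicator f) 2 μ := by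
    have := hiso (m2.toLp _)
    rw [Lp.norm_def, Lp.norm_def, ENNReal.toReal_eq_toReal_iff' (Lp.eLpNorm_ne_top _)
      (Lp.eLpNorm_ne_top _)] at this
    rw [this, eLpNorm_congr_ae m2.coeFn_toLp]
  have hE2 : eLpNorm ({x | ‖f x‖ ≤ h}.indicator f) 2 μ ^ (2 : ℝ) =
      ∫⁻ x, ENNReal.ofReal (if ‖f x‖ ≤ h then ‖f x‖ ^ 2 else 0) ∂μ := by
    rw [eLpNorm_eq_lintegral_rpow_enorm_toReal (by norm_num) (by norm_num)]
    simp only [ENNReal.toReal_ofNat]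
    rw [← ENNReal.rpow_mul]
    norm_num
    refine lintegral_congr fun x => ?_
    by_cases hx : ‖f x‖ ≤ h
    · simp [hx, ← ofReal_norm, ENNReal.ofReal_pow]
    · simp [hx]
  refine hsub.trans ?_
  simp only [ENNReal.toReal_ofNat] at hcheb
  rw [hE, hE2] at hcheb
  have hc : ENNReal.ofReal (t / 2) ^ (2 : ℝ) = ENNReal.ofReal (t ^ 2 / 4) := by
    rw [ENNReal.ofReal_rpow_of_pos (by positivity)]
    congr 1
    norm_num
    ring
  rw [hc] at hcheb
  calc _ = ENNReal.ofReal (4 / t ^ 2) * (ENNReal.ofReal (t ^ 2 / 4) * ν {y | ENNReal.ofReal (t / 2) ≤ ‖T (m2.toLp _) y‖ₑ}) := by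
        rw [← mul_assoc, ← ENNReal.ofReal_mul (by positivity)]
        have : 4 / t ^ 2 * (t ^ 2 / 4) = 1 := by field_simp
        rw [this]; simp
    _ ≤ _ := mul_le_mul_right hcheb _
    _ = _ := by
        rw [← lintegral_const_mul' _ _ ENNReal.ofReal_ne_top]
        refine lintegral_congr fun x => ?_
        rw [ENNReal.ofReal_mul (by positivity)]

/-- The inner integral in the interpolation argument. -/
theorem lintegral_truncation_le {p q A y : ℝ} (hp : 1 < p) (hq : 2 < q) (hA : 0 < A)
    (hpq : (p - 1) * (q - 2) = 2 - p) (hy : 0 ≤ y) :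
    ∫⁻ t in Set.Ioi (0 : ℝ),
        ENNReal.ofReal (4 / t ^ 2 * (if y ≤ (2 * A / t) ^ (1 / (p - 1)) then y ^ 2 else 0)) *
          ENNReal.ofReal (t ^ (q - 1)) ≤
      ENNReal.ofReal (4 / (q - 2) * (2 * A) ^ (q - 2) * y ^ p) := by
  rcases hy.eq_or_lt with rfl | hy
  · simp
  have hp1 : 0 < p - 1 := by linarith
  -- The truncation condition on `y` is equivalent to `t ≤ M`; the integrand becomes `t^(q-3)` on
  -- `(0, M]`, integrable at `0` because `q > 2`.
  set M : ℝ := 2 * A * y ^ (-(p - 1)) with hM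
  have hMpos : 0 < M := by positivity
  have hle : ∀ t ∈ Set.Ioi (0 : ℝ),
      ENNReal.ofReal (4 / t ^ 2 * (if y ≤ (2 * A / t) ^ (1 / (p - 1)) then y ^ 2 else 0)) *
          ENNReal.ofReal (t ^ (q - 1)) ≤
        (Set.Ioc 0 M).indicator (fun t => ENNReal.ofReal (4 * y ^ 2 * t ^ (q - 3))) t := by
    intro t ht
    have ht : 0 < t := ht
    by_cases hc : y ≤ (2 * A / t) ^ (1 / (p - 1))
    · have hmem : t ∈ Set.Ioc 0 M := by
        refine ⟨ht, ?_⟩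
        have h1 : y ^ (p - 1) ≤ 2 * A / t := by
          calc y ^ (p - 1) ≤ ((2 * A / t) ^ (1 / (p - 1))) ^ (p - 1) := by gcongr
            _ = 2 * A / t := by
              rw [← Real.rpow_mul (by positivity), one_div_mul_cancel hp1.ne', Real.rpow_one]
        rw [hM, Real.rpow_neg hy.le, ← div_eq_mul_inv, le_div_iff₀ (by positivity)]
        rw [le_div_iff₀ ht] at h1
        linarith
      rw [Set.indicator_of_mem hmem, if_pos hc, ← ENNReal.ofReal_mul (by positivity)]
      refine ENNReal.ofReal_le_ofReal (le_of_eq ?_)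
      have : t ^ (q - 1) = t ^ (q - 3) * t ^ 2 := by
        rw [← Real.rpow_natCast, ← Real.rpow_add ht]; congr 1; push_cast; ring
      rw [this]
      field_simp
    · rw [if_neg hc]
      simp
  refine (setLIntegral_mono' measurableSet_Ioi hle).trans ?_
  rw [lintegral_indicator measurableSet_Ioc, Measure.restrict_restrict measurableSet_Ioc,
    Set.inter_eq_left.2 Set.Ioc_subset_Ioi_self]
  have hint : IntegrableOn (fun t : ℝ => 4 * y ^ 2 * t ^ (q - 3)) (Set.Ioc 0 M) := by
    have := (intervalIntegral.intervalIntegrable_rpow' (a := 0) (b := M) (r := q - 3)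
      (by linarith)).const_mul (4 * y ^ 2)
    rwa [intervalIntegrable_iff_integrableOn_Ioc_of_le hMpos.le] at this
  rw [← ofReal_integral_eq_lintegral_ofReal hint]
  · refine ENNReal.ofReal_le_ofReal (le_of_eq ?_)
    rw [← intervalIntegral.integral_of_le hMpos.le, intervalIntegral.integral_const_mul,
      integral_rpow (Or.inl (by linarith))]
    have e1 : q - 3 + 1 = q - 2 := by ring
    rw [e1, Real.zero_rpow (by linarith), hM, Real.mul_rpow (by positivity) (by positivity),
      ← Real.rpow_mul hy.le]
    have e2 : y ^ p = y ^ 2 * y ^ (-(p - 1) * (q - 2)) := by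
      rw [← Real.rpow_natCast, ← Real.rpow_add hy]; congr 1; push_cast; linarith
    rw [e2]
    field_simp
    ring
  · filter_upwards [ae_restrict_mem measurableSet_Ioc] with t ht
    have := ht.1
    positivity

/-- Interpolation of an isometry of `L²` which is bounded from `L¹` to `L^∞`. -/
theorem exists_eLpNorm_le_of_isometry_of_sup {β : Type*} [MeasurableSpace β] {ν : Measure β}
    [SFinite μ]
    (T : Lp F 2 μ → Lp F 2 ν) (hadd : ∀ f g, T (f + g) = T f + T g)
    (hiso : ∀ f, ‖T f‖ = ‖f‖)
    (hsup : ∀ f, eLpNorm (T f) ⊤ ν ≤ eLpNorm f 1 μ) {p q : ℝ} (hp : 1 < p) (hp2 : p < 2)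
    (hpq : p.HolderConjugate q) :
    ∃ C : ℝ, 0 < C ∧ ∀ f, eLpNorm (T f) (ENNReal.ofReal q) ν ≤
      ENNReal.ofReal C * eLpNorm f (ENNReal.ofReal p) μ := by
  have hq2 : 2 < q := by
    have := hpq.mul_eq_add
    nlinarith
  -- Conjugacy in the form that turns `y² M^(q-2)` into a multiple of `y^p`.
  have hexp : (p - 1) * (q - 2) = 2 - p := by
    have := hpq.mul_eq_add
    linarith
  have hp0 : 0 < p := by linarith
  have hq0 : 0 < q := by linarith
  set B : ℝ := q * (4 / (q - 2) * 2 ^ (q - 2)) with hB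
  have hBpos : 0 < B := by
    have : 0 < q - 2 := by linarith
    positivity
  refine ⟨B ^ (1 / q), by positivity, fun f => ?_⟩
  have hfm : StronglyMeasurable f := Lp.stronglyMeasurable f
  by_cases hfin : eLpNorm f (ENNReal.ofReal p) μ = ⊤
  · rw [hfin, ENNReal.mul_top (by simp; positivity)]
    exact le_top
  have hmem : MemLp f (ENNReal.ofReal p) μ := ⟨Lp.aestronglyMeasurable f, lt_top_iff_ne_top.2 hfin⟩
  have hfp : Integrable (fun x => ‖f x‖ ^ p) μ := by
    simpa [hp0.le] using hmem.integrable_norm_rpow (by simpa using hp0) (by simp)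
  set A : ℝ := ∫ x, ‖f x‖ ^ p ∂μ with hA
  have hnorm : eLpNorm f (ENNReal.ofReal p) μ = ENNReal.ofReal (A ^ (1 / p)) := by
    rw [hmem.eLpNorm_eq_integral_rpow_norm (by simpa using hp0) (by simp)]
    simp [hp0.le, hA]
  have hA0 : 0 ≤ A := integral_nonneg fun x => by positivity
  rcases hA0.eq_or_lt with hA0 | hApos
  · have hz : f = 0 := by
      rw [← hA0, Real.zero_rpow (by positivity), ENNReal.ofReal_zero,
        eLpNorm_eq_zero_iff (Lp.aestronglyMeasurable f) (by simpa using hp0)] at hnorm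
      exact Lp.ext (hnorm.trans (Lp.coeFn_zero ..).symm)
    have hT : T f = 0 := by
      rw [← norm_eq_zero, hiso, hz, norm_zero]
    rw [hT, eLpNorm_congr_ae (Lp.coeFn_zero ..)]
    simp
  have hlayer : ∫⁻ y, ENNReal.ofReal (‖T f y‖ ^ q) ∂ν ≤ ENNReal.ofReal (B * A ^ (q - 1)) := by
    rw [lintegral_rpow_eq_lintegral_meas_lt_mul ν (ae_of_all _ fun _ => norm_nonneg _)
      (Lp.aestronglyMeasurable (T f)).norm.aemeasurable hq0]
    -- The height `h = (2A/t)^(1/(p-1))` solves `h^(1-p) A = t/2`.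
    have hstep : ∀ t ∈ Set.Ioi (0 : ℝ), ν {y | t < ‖T f y‖} * ENNReal.ofReal (t ^ (q - 1)) ≤
        ∫⁻ x, ENNReal.ofReal (4 / t ^ 2 *
          (if ‖f x‖ ≤ (2 * A / t) ^ (1 / (p - 1)) then ‖f x‖ ^ 2 else 0)) *
            ENNReal.ofReal (t ^ (q - 1)) ∂μ := by
      intro t ht
      have ht : 0 < t := ht
      rw [lintegral_mul_const' _ _ ENNReal.ofReal_ne_top]
      gcongr
      refine meas_lt_norm_le_of_split T hadd hiso hsup hp f hfp ht (by positivity) (le_of_eq ?_)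
      have : 1 / (p - 1) * (1 - p) = -1 := by
        have : p - 1 ≠ 0 := by linarith
        field_simp
        ring
      rw [← Real.rpow_mul (by positivity), this, Real.rpow_neg_one, ← hA]
      field_simp
    have hmeas : Measurable (Function.uncurry fun (t : ℝ) (x : α) =>
        ENNReal.ofReal (4 / t ^ 2 *
          (if ‖f x‖ ≤ (2 * A / t) ^ (1 / (p - 1)) then ‖f x‖ ^ 2 else 0)) *
            ENNReal.ofReal (t ^ (q - 1))) := by
      have hn : Measurable fun z : ℝ × α => ‖f z.2‖ := hfm.norm.measurable.comp measurable_snd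
      have hset : MeasurableSet {z : ℝ × α | ‖f z.2‖ ≤ (2 * A / z.1) ^ (1 / (p - 1))} :=
        measurableSet_le hn (by fun_prop)
      have hite : Measurable fun z : ℝ × α =>
          (if ‖f z.2‖ ≤ (2 * A / z.1) ^ (1 / (p - 1)) then ‖f z.2‖ ^ 2 else 0) :=
        Measurable.ite hset (hn.pow_const 2) measurable_const
      unfold Function.uncurry
      fun_prop
    calc ENNReal.ofReal q * ∫⁻ t in Set.Ioi 0, ν {y | t < ‖T f y‖} * ENNReal.ofReal (t ^ (q - 1))
        ≤ ENNReal.ofReal q * ∫⁻ t in Set.Ioi (0 : ℝ), ∫⁻ x, ENNReal.ofReal (4 / t ^ 2 *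
          (if ‖f x‖ ≤ (2 * A / t) ^ (1 / (p - 1)) then ‖f x‖ ^ 2 else 0)) *
            ENNReal.ofReal (t ^ (q - 1)) ∂μ := by
          gcongr 1
          exact setLIntegral_mono' measurableSet_Ioi hstep
      _ ≤ ENNReal.ofReal q *
          ∫⁻ x, ENNReal.ofReal (4 / (q - 2) * (2 * A) ^ (q - 2) * ‖f x‖ ^ p) ∂μ := by
          rw [lintegral_lintegral_swap hmeas.aemeasurable]
          gcongr with x
          exact lintegral_truncation_le hp hq2 hApos hexp (norm_nonneg _)
      _ = _ := by
          have : 0 ≤ 4 / (q - 2) * (2 * A) ^ (q - 2) := by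
            have : 0 < q - 2 := by linarith
            positivity
          rw [← ofReal_integral_eq_lintegral_ofReal (hfp.const_mul _)
            (ae_of_all _ fun x => by positivity), integral_const_mul,
            ← ENNReal.ofReal_mul hq0.le, ← hA, Real.mul_rpow (by norm_num) hApos.le]
          have : A ^ (q - 1) = A ^ (q - 2) * A := by
            nth_rw 3 [← Real.rpow_one A]
            rw [← Real.rpow_add hApos]; congr 1; ring
          rw [this, hB]
          congr 1
          ring
  rw [hnorm, ← ENNReal.ofReal_mul (by positivity),
    eLpNorm_eq_lintegral_rpow_enorm_toReal (by simpa using hq0) (by simp)]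
  rw [ENNReal.toReal_ofReal hq0.le]
  have hen : ∀ y, ‖T f y‖ₑ ^ q = ENNReal.ofReal (‖T f y‖ ^ q) := fun y => by
    rw [← ofReal_norm, ENNReal.ofReal_rpow_of_nonneg (norm_nonneg _) hq0.le]
  simp only [hen]
  calc _ ≤ ENNReal.ofReal (B * A ^ (q - 1)) ^ (1 / q) := by gcongr
    _ = _ := by
      rw [ENNReal.ofReal_rpow_of_nonneg (by positivity) (by positivity),
        Real.mul_rpow (by positivity) (by positivity), ← Real.rpow_mul hApos.le]
      -- The exponents match because `(q-1)/q = 1/p`.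
      congr 3
      have := hpq.mul_eq_add
      field_simp
      linarith

end Interpolation

/-! ### Hausdorff–Young and multiplier bounds. -/

section HausdorffYoung

variable {E F : Type*} [NormedAddCommGroup E] [MeasurableSpace E] [BorelSpace E]
  [NormedAddCommGroup F] [InnerProductSpace ℂ F] [CompleteSpace F]
  [InnerProductSpace ℝ E] [FiniteDimensional ℝ E]

/-- The Hausdorff–Young inequality (with an unspecified constant). -/
theorem exists_eLpNorm_fourier_le {p q : ℝ≥0∞} (hp : 1 ≤ p) (hp2 : p ≤ 2)
    [hpq : p.HolderConjugate q] :
    ∃ C : ℝ, 0 < C ∧ ∀ f : Lp F 2 (volume : Measure E),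
      eLpNorm (𝓕 f : Lp F 2 (volume : Measure E)) q volume ≤
        ENNReal.ofReal C * eLpNorm f p volume := by
  rcases hp.eq_or_lt with rfl | hp
  · have hq : q = ⊤ := by
      have := hpq.inv_add_inv_eq_inv
      simpa using this
    subst hq
    exact ⟨1, one_pos, fun f => by simpa using eLpNorm_fourier_top_le f⟩
  rcases hp2.eq_or_lt with rfl | hp2
  · have hq : q = 2 := ENNReal.HolderConjugate.unique 2 q 2
    subst hq
    refine ⟨1, one_pos, fun f => ?_⟩
    have := Lp.norm_fourier_eq f
    rw [Lp.norm_def, Lp.norm_def, ENNReal.toReal_eq_toReal_iff' (Lp.eLpNorm_ne_top _)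
      (Lp.eLpNorm_ne_top _)] at this
    simp [this]
  · have hpt : p ≠ ⊤ := (hp2.trans (by norm_num)).ne
    have hp' : 1 < p.toReal := by
      have := (ENNReal.toReal_lt_toReal (by norm_num) hpt).2 hp
      simpa using this
    have hp2' : p.toReal < 2 := by
      have := (ENNReal.toReal_lt_toReal hpt (by norm_num)).2 hp2
      simpa using this
    have hqt : q ≠ ⊤ := by
      rintro rfl
      have := hpq.inv_add_inv_eq_inv
      simp at this
      exact hp.ne' this
    have hconj : p.toReal.HolderConjugate q.toReal := ENNReal.HolderConjugate.toReal hp'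
    obtain ⟨C, hC, h⟩ := exists_eLpNorm_le_of_isometry_of_sup (μ := (volume : Measure E))
      (ν := (volume : Measure E)) (fun f : Lp F 2 (volume : Measure E) =>
        (𝓕 f : Lp F 2 (volume : Measure E))) FourierTransform.fourier_add Lp.norm_fourier_eq
      eLpNorm_fourier_top_le hp' hp2' hconj
    refine ⟨C, hC, fun f => ?_⟩
    have := h f
    rwa [ENNReal.ofReal_toReal hpt, ENNReal.ofReal_toReal hqt] at this

/-- `L^p → L^q` bounds for Fourier multipliers from the size of the symbol alone. -/
theorem exists_eLpNorm_fourierInv_le {p q : ℝ≥0∞} (hp : 1 ≤ p) (hp2 : p ≤ 2) (hq : 2 ≤ q) :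
    ∃ C : ℝ, 0 < C ∧ ∀ (g f : Lp F 2 (volume : Measure E)) (m : E → ℝ), Measurable m →
      (∀ᵐ k, ‖g k‖ ≤ m k * ‖(𝓕 f : Lp F 2 (volume : Measure E)) k‖) →
      eLpNorm (𝓕⁻ g : Lp F 2 (volume : Measure E)) q volume ≤
        ENNReal.ofReal C * eLpNorm m (p⁻¹ - q⁻¹)⁻¹ volume * eLpNorm f p volume := by
  have hq1 : 1 ≤ q := one_le_two.trans hq
  have hpi : p⁻¹ ≤ 1 := by simpa using hp
  have hqi : q⁻¹ ≤ 1 := by simpa using hq1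
  have hqp : q⁻¹ ≤ p⁻¹ := ENNReal.inv_le_inv.2 (hp2.trans hq)
  have hqi2 : q⁻¹ ≤ 2⁻¹ := ENNReal.inv_le_inv.2 hq
  set p' : ℝ≥0∞ := (1 - p⁻¹)⁻¹ with hp'
  set q' : ℝ≥0∞ := (1 - q⁻¹)⁻¹ with hq'
  have c1 : p.HolderConjugate p' := ENNReal.HolderConjugate.inv_one_sub_inv' hp
  have c2' : q.HolderConjugate q' := ENNReal.HolderConjugate.inv_one_sub_inv' hq1
  have c2 : q'.HolderConjugate q := ENNReal.HolderConjugate.symm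
  have hq'1 : 1 ≤ q' := by rw [hq', ENNReal.one_le_inv]; exact tsub_le_self
  have hq'2 : q' ≤ 2 := by
    rw [hq', ENNReal.inv_le_iff_inv_le]
    calc (2 : ℝ≥0∞)⁻¹ = 1 - 2⁻¹ := ENNReal.one_sub_inv_two.symm
      _ ≤ _ := tsub_le_tsub_left hqi2 _
  -- Hölder's relation for the symbol: `1/q' = (1/p - 1/q) + 1/p'`.
  have c3 : ENNReal.HolderTriple (p⁻¹ - q⁻¹)⁻¹ p' q' := ⟨by
    rw [hp', hq', inv_inv, inv_inv, inv_inv, add_comm, tsub_add_tsub_cancel hpi hqp]⟩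
  obtain ⟨C₁, hC₁, h₁⟩ := exists_eLpNorm_fourier_le (E := E) (F := F) (q := p') hp hp2
  obtain ⟨C₂, hC₂, h₂⟩ := exists_eLpNorm_fourier_le (E := E) (F := F) (q := q) hq'1 hq'2
  refine ⟨C₂ * C₁, by positivity, fun g f m hm hg => ?_⟩
  have hg' : eLpNorm g q' volume ≤
      eLpNorm m (p⁻¹ - q⁻¹)⁻¹ volume *
        eLpNorm (𝓕 f : Lp F 2 (volume : Measure E)) p' volume := by
    have hmul : eLpNorm g q' volume ≤
        eLpNorm (m • fun k => ‖(𝓕 f : Lp F 2 (volume : Measure E)) k‖) q' volume := by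
      refine eLpNorm_mono_ae ?_
      filter_upwards [hg] with k hk
      exact hk.trans (le_abs_self _)
    refine hmul.trans ?_
    have := eLpNorm_smul_le_mul_eLpNorm (μ := (volume : Measure E))
      (p := (p⁻¹ - q⁻¹)⁻¹) (q := p') (r := q')
      (Lp.aestronglyMeasurable (𝓕 f : Lp F 2 (volume : Measure E))).norm
      hm.aestronglyMeasurable
    rwa [eLpNorm_norm] at this
  calc _ = eLpNorm (𝓕 g : Lp F 2 (volume : Measure E)) q volume := eLpNorm_fourierInv g q
    _ ≤ ENNReal.ofReal C₂ * eLpNorm g q' volume := h₂ g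
    _ ≤ ENNReal.ofReal C₂ * (eLpNorm m (p⁻¹ - q⁻¹)⁻¹ volume *
        (ENNReal.ofReal C₁ * eLpNorm f p volume)) := by
      gcongr
      exact hg'.trans (by gcongr; exact h₁ f)
    _ = _ := by rw [ENNReal.ofReal_mul hC₂.le]; ring

end HausdorffYoung

/-! ### Integrability of the Bessel and Gaussian majorants. -/

section SymbolNorms

variable {E : Type*} [NormedAddCommGroup E] [InnerProductSpace ℝ E] [FiniteDimensional ℝ E]
  [MeasurableSpace E] [BorelSpace E]

/-- Here `ρ` plays the role of `1/p - 1/q`. The `ρ⁻¹`-th power of the weight decays like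
`|k|^(-s/ρ)`, integrable since `s/ρ` exceeds the dimension; `ρ = 0` is the sup norm. -/
theorem eLpNorm_bessel_lt_top {ρ : ℝ≥0∞} {s : ℝ}
    (hs : Module.finrank ℝ E * ρ.toReal < s) :
    eLpNorm (fun k : E => (1 + ‖(2 * Real.pi) • k‖ ^ 2) ^ (-(s / 2))) ρ⁻¹ volume < ⊤ := by
  have hs0 : 0 < s := lt_of_le_of_lt (by positivity) hs
  have hmeas : AEStronglyMeasurable (fun k : E => (1 + ‖(2 * Real.pi) • k‖ ^ 2) ^ (-(s / 2)))
      volume := by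
    refine Measurable.aestronglyMeasurable ?_
    fun_prop
  by_cases h0 : ρ = 0
  · rw [h0, ENNReal.inv_zero]
    refine (memLp_top_of_bound hmeas 1 (ae_of_all _ fun k => ?_)).2
    rw [Real.norm_of_nonneg (by positivity)]
    exact Real.rpow_le_one_of_one_le_of_nonpos (by simp) (by linarith)
  by_cases ht : ρ = ⊤
  · rw [ht, ENNReal.inv_top]
    simp
  have hr : 0 < ρ.toReal := ENNReal.toReal_pos h0 ht
  have hmem : MemLp (fun k : E => (1 + ‖(2 * Real.pi) • k‖ ^ 2) ^ (-(s / 2))) ρ⁻¹ volume := by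
    rw [← integrable_norm_rpow_iff hmeas (by simpa using ht) (by simpa using h0)]
    have hlt : (Module.finrank ℝ E : ℝ) < s / ρ.toReal := by
      rwa [lt_div_iff₀ hr]
    have hi := (integrable_rpow_neg_one_add_norm_sq (E := E) (μ := volume) hlt).comp_smul
      (R := 2 * Real.pi) (by positivity)
    refine hi.congr (ae_of_all _ fun k => ?_)
    simp only [ENNReal.toReal_inv]
    rw [Real.norm_of_nonneg (by positivity), ← Real.rpow_mul (by positivity)]
    congr 1
    field_simp
  exact hmem.2

/-- The Gaussian integral scales as `(1+t)^(-N/2)`, and the norm is its `ρ`-th power. Using `1+t`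
keeps the bound finite at `t = 0`. -/
theorem exists_eLpNorm_gaussian_le {ρ : ℝ≥0∞} (hρ : ρ ≠ ⊤) {b : ℝ} (hb : 0 < b) :
    ∃ K : ℝ, 0 < K ∧ ∀ t : ℝ, 0 ≤ t →
      eLpNorm (fun k : E => Real.exp (-(b * (1 + t)) * ‖k‖ ^ 2)) ρ⁻¹ volume ≤
        ENNReal.ofReal (K * (1 + t) ^ (-((Module.finrank ℝ E : ℝ) / 2) * ρ.toReal)) := by
  by_cases h0 : ρ = 0
  · refine ⟨1, one_pos, fun t ht => ?_⟩
    rw [h0]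
    simp only [ENNReal.inv_zero, ENNReal.toReal_zero, mul_zero, Real.rpow_zero, mul_one,
      ENNReal.ofReal_one, eLpNorm_exponent_top]
    refine eLpNormEssSup_le_of_ae_enorm_bound (ae_of_all _ fun k => ?_)
    rw [← ofReal_norm, Real.norm_of_nonneg (Real.exp_pos _).le]
    refine ENNReal.ofReal_le_one.2 (Real.exp_le_one_iff.2 ?_)
    have : 0 ≤ b * (1 + t) * ‖k‖ ^ 2 := by positivity
    linarith
  have hr : 0 < ρ.toReal := ENNReal.toReal_pos h0 hρ
  set N : ℝ := (Module.finrank ℝ E : ℝ) with hN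
  refine ⟨(Real.pi * ρ.toReal / b) ^ (N / 2 * ρ.toReal), by positivity, fun t ht => ?_⟩
  have h1t : 0 < 1 + t := by linarith
  have hfun : ∀ k : E, ‖Real.exp (-(b * (1 + t)) * ‖k‖ ^ 2)‖ₑ ^ (ρ⁻¹).toReal =
      ENNReal.ofReal (Real.exp (-(b * (1 + t) / ρ.toReal) * ‖k‖ ^ 2)) := fun k => by
    rw [← ofReal_norm, Real.norm_of_nonneg (Real.exp_pos _).le,
      ENNReal.ofReal_rpow_of_pos (Real.exp_pos _), ← Real.exp_mul, ENNReal.toReal_inv]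
    congr 2
    field_simp
  have hc : 0 < b * (1 + t) / ρ.toReal := by positivity
  have hint : Integrable (fun k : E => Real.exp (-(b * (1 + t) / ρ.toReal) * ‖k‖ ^ 2)) volume := by
    -- A non-integrable function has integral `0` by convention, while the closed formula is
    -- positive.
    by_contra hcon
    have h1 := GaussianFourier.integral_rexp_neg_mul_sq_norm (V := E) hc
    rw [integral_undef hcon] at h1
    have : 0 < (Real.pi / (b * (1 + t) / ρ.toReal)) ^ (N / 2) := by positivity
    exact this.ne h1
  rw [eLpNorm_eq_lintegral_rpow_enorm_toReal (by simpa using hρ) (by simpa using h0)]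
  simp only [hfun]
  rw [← ofReal_integral_eq_lintegral_ofReal hint (ae_of_all _ fun k => (Real.exp_pos _).le),
    GaussianFourier.integral_rexp_neg_mul_sq_norm hc, ENNReal.toReal_inv, one_div, inv_inv,
    ENNReal.ofReal_rpow_of_pos (by positivity)]
  refine ENNReal.ofReal_le_ofReal (le_of_eq ?_)
  rw [← Real.rpow_mul (by positivity)]
  have e : Real.pi / (b * (1 + t) / ρ.toReal) = Real.pi * ρ.toReal / b * (1 + t)⁻¹ := by
    field_simp
  rw [e, Real.mul_rpow (by positivity) (by positivity), Real.inv_rpow h1t.le,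
    ← Real.rpow_neg h1t.le, neg_mul]

end SymbolNorms

/-! ### The normal-form corrector and its derivative. -/

section Corrector

variable {ι : Type*}

/-- Coefficients of the elastic part of the corrector (they vanish on the diagonal). -/
def correctorCoeff (μ α : ι → ℝ) (k l : ι) : ℂ :=
  (α k * α l : ℂ) / (Complex.I * ((μ l : ℂ) - μ k))

/-- This is the homological equation: off the diagonal the oscillation `i(μ_l - μ_k)` is divided out
exactly. On the diagonal division by zero returns `0`, and the resonant term survives. -/
theorem correctorCoeff_mul [DecidableEq ι] {μ α : ι → ℝ} (hμ : ∀ k l, k ≠ l → μ l - μ k ≠ 0)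
    (k l : ι) :
    correctorCoeff μ α k l * (Complex.I * ((μ l : ℂ) - μ k)) =
      (α k * α l : ℂ) - if l = k then (α k * α l : ℂ) else 0 := by
  by_cases h : l = k
  · subst h; simp
  · have : ((μ l : ℂ) - μ k) ≠ 0 := by exact_mod_cast hμ k l (Ne.symm h)
    rw [correctorCoeff, div_mul_cancel₀ _ (mul_ne_zero Complex.I_ne_zero this)]
    simp [h]

theorem norm_correctorCoeff_le {μ α : ι → ℝ} {δ : ℝ} (hδ : 0 < δ)
    (hμ : ∀ k l, k ≠ l → δ ≤ |μ l - μ k|) (hα : ∀ k, |α k| ≤ 1) (k l : ι) :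
    ‖correctorCoeff μ α k l‖ ≤ δ⁻¹ := by
  by_cases h : k = l
  · subst h; simp [correctorCoeff, hδ.le]
  · have h1 : ‖((μ l : ℂ) - μ k)‖ = |μ l - μ k| := by
      rw [← Complex.ofReal_sub, Complex.norm_real, Real.norm_eq_abs]
    rw [correctorCoeff, norm_div, norm_mul, norm_mul, Complex.norm_I, one_mul, h1,
      Complex.norm_real, Complex.norm_real, Real.norm_eq_abs, Real.norm_eq_abs, ← one_div]
    exact div_le_div₀ zero_le_one (mul_le_one₀ (hα k) (abs_nonneg _) (hα l)) hδ (hμ k l h)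

variable [Fintype ι]

/-- The sesquilinear corrector, polarised: `v`, `η` stand for the conjugates of `u`, `θ`. -/
def corrector (γ : ℝ) (μ α : ι → ℝ) (u v : ι → ℂ) (θ : ℂ) : ℂ :=
  ∑ k, ((α k : ℂ) * (v k * θ) - γ / 2 * ∑ l, correctorCoeff μ α k l * (v k * u l))

/-- The remainder in the derivative of the corrector; every term contains the temperature. -/
def correctorRemainder (γ d : ℝ) (μ α : ι → ℝ) (u v : ι → ℂ) (θ η : ℂ) : ℂ :=
  ∑ k, ((α k : ℂ) * (-(Complex.I * μ k) * (v k * θ) - γ * α k * (η * θ) - d * (v k * θ)) +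
    γ ^ 2 / 2 * ∑ l, correctorCoeff μ α k l * (α k * (η * u l) + α l * (v k * θ)))

/-- The term `α_k v_k dθ` yields every product `α_k α_l v_k u_l`; the normal-form sum cancels those
with `l ≠ k` and leaves the coercive diagonal. Keeping `v, η` independent of `u, θ` makes this pure
algebra. -/
theorem corrector_deriv_identity {μ α : ι → ℝ} (hμ : ∀ k l, k ≠ l → μ l - μ k ≠ 0) (γ d : ℝ)
    (u v du dv : ι → ℂ) (θ η dθ : ℂ)
    (hdu : ∀ k, du k = Complex.I * μ k * u k - γ * α k * θ)
    (hdv : ∀ k, dv k = -(Complex.I * μ k) * v k - γ * α k * η)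
    (hdθ : dθ = γ / 2 * ∑ k, α k * u k - d * θ) :
    ∑ k, ((α k : ℂ) * (dv k * θ + v k * dθ) -
        γ / 2 * ∑ l, correctorCoeff μ α k l * (dv k * u l + v k * du l)) =
      γ / 2 * ∑ k, (α k : ℂ) ^ 2 * (v k * u k) + correctorRemainder γ d μ α u v θ η := by
  classical
  rw [correctorRemainder, Finset.mul_sum, ← Finset.sum_add_distrib]
  refine Finset.sum_congr rfl fun k _ => ?_
  have hk : ∑ l, ((α k * α l : ℂ) - correctorCoeff μ α k l * (Complex.I * ((μ l : ℂ) - μ k))) *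
      (v k * u l) = (α k : ℂ) ^ 2 * (v k * u k) := by
    rw [Finset.sum_eq_single k]
    · rw [correctorCoeff_mul hμ]; simp [sq]
    · intro l _ hl
      rw [correctorCoeff_mul hμ]; simp [hl]
    · simp
  have hsplit : ∑ l, correctorCoeff μ α k l * (dv k * u l + v k * du l) =
      (α k : ℂ) * v k * ∑ l, α l * u l - (α k : ℂ) ^ 2 * (v k * u k)
        - γ * ∑ l, correctorCoeff μ α k l * (α k * (η * u l) + α l * (v k * θ)) := by
    rw [← hk, Finset.mul_sum, Finset.mul_sum, ← Finset.sum_sub_distrib, ← Finset.sum_sub_distrib]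
    refine Finset.sum_congr rfl fun l _ => ?_
    rw [hdu, hdv]
    ring
  rw [hsplit, hdv, hdθ]
  ring

/-- Each summand carries a factor `θ` or `η`, so no term quadratic in `u` alone appears and heat
dissipation can absorb the remainder. -/
theorem norm_correctorRemainder_le {μ α : ι → ℝ} {γ d δ M : ℝ} (hδ : 0 < δ) (hd : 0 ≤ d)
    (hμ : ∀ k l, k ≠ l → δ ≤ |μ l - μ k|) (hM : ∀ k, |μ k| ≤ M) (hα : ∀ k, |α k| ≤ 1)
    (u v : ι → ℂ) (θ η : ℂ) (hv : ∀ k, ‖v k‖ = ‖u k‖) (hη : ‖η‖ = ‖θ‖) :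
    ‖correctorRemainder γ d μ α u v θ η‖ ≤
      (M + d + γ ^ 2 * δ⁻¹ * Fintype.card ι) * (‖θ‖ * ∑ k, ‖u k‖) +
        Fintype.card ι * |γ| * ‖θ‖ ^ 2 := by
  have hα' : ∀ k, ‖(α k : ℂ)‖ ≤ 1 := fun k => by
    rw [Complex.norm_real]; exact hα k
  have hμ' : ∀ k, ‖(μ k : ℂ)‖ ≤ M := fun k => by
    rw [Complex.norm_real]; exact hM k
  have hterm : ∀ k, ‖((α k : ℂ) * (-(Complex.I * μ k) * (v k * θ) - γ * α k * (η * θ) -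
      d * (v k * θ)) + γ ^ 2 / 2 * ∑ l, correctorCoeff μ α k l *
        (α k * (η * u l) + α l * (v k * θ)))‖ ≤
      (M + d) * (‖θ‖ * ‖u k‖) + |γ| * ‖θ‖ ^ 2 +
        γ ^ 2 / 2 * (δ⁻¹ * (‖θ‖ * ∑ l, ‖u l‖ + Fintype.card ι * (‖θ‖ * ‖u k‖))) := by
    intro k
    refine (norm_add_le _ _).trans (add_le_add ?_ ?_)
    · rw [norm_mul]
      refine (mul_le_of_le_one_left (norm_nonneg _) (hα' k)).trans ?_
      refine (norm_sub_le _ _).trans ?_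
      have h1 : ‖-(Complex.I * μ k) * (v k * θ)‖ ≤ M * (‖θ‖ * ‖u k‖) := by
        rw [norm_mul, norm_neg, norm_mul, Complex.norm_I, one_mul, norm_mul, hv,
          mul_comm ‖u k‖]
        exact mul_le_mul_of_nonneg_right (hμ' k) (by positivity)
      have h2 : ‖(γ : ℂ) * α k * (η * θ)‖ ≤ |γ| * ‖θ‖ ^ 2 := by
        rw [norm_mul, norm_mul, norm_mul, hη, ← sq, Complex.norm_real, Real.norm_eq_abs]
        gcongr
        exact mul_le_of_le_one_right (abs_nonneg _) (hα' k)
      have h3 : ‖(d : ℂ) * (v k * θ)‖ = d * (‖θ‖ * ‖u k‖) := by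
        rw [norm_mul, norm_mul, hv, Complex.norm_real, Real.norm_of_nonneg hd, mul_comm ‖u k‖]
      have h4 := norm_sub_le (-(Complex.I * μ k) * (v k * θ)) (γ * α k * (η * θ))
      linarith
    · rw [norm_mul]
      have : ‖(γ : ℂ) ^ 2 / 2‖ = γ ^ 2 / 2 := by
        rw [norm_div, norm_pow, Complex.norm_real, Real.norm_eq_abs, sq_abs]; simp
      rw [this]
      gcongr
      refine (norm_sum_le _ _).trans ?_
      calc ∑ l, ‖correctorCoeff μ α k l * (α k * (η * u l) + α l * (v k * θ))‖
          ≤ ∑ l, δ⁻¹ * (‖θ‖ * ‖u l‖ + ‖θ‖ * ‖u k‖) := by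
            refine Finset.sum_le_sum fun l _ => ?_
            rw [norm_mul]
            refine mul_le_mul (norm_correctorCoeff_le hδ hμ hα k l) ?_ (norm_nonneg _)
              (by positivity)
            refine (norm_add_le _ _).trans (add_le_add ?_ ?_)
            · rw [norm_mul, norm_mul, hη]
              exact mul_le_of_le_one_left (by positivity) (hα' k)
            · rw [norm_mul, norm_mul, hv, mul_comm ‖u k‖]
              exact mul_le_of_le_one_left (by positivity) (hα' l)
        _ = _ := by
            rw [← Finset.mul_sum, Finset.sum_add_distrib, ← Finset.mul_sum]
            simp
  refine (norm_sum_le _ _).trans ((Finset.sum_le_sum fun k _ => hterm k).trans (le_of_eq ?_))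
  simp only [Finset.sum_add_distrib, ← Finset.mul_sum, Finset.sum_const, Finset.card_univ,
    nsmul_eq_mul]
  ring

/-- Used to show that a small multiple of the corrector leaves the energy comparable to itself. -/
theorem norm_corrector_le {μ α : ι → ℝ} {γ δ : ℝ} (hδ : 0 < δ)
    (hμ : ∀ k l, k ≠ l → δ ≤ |μ l - μ k|) (hα : ∀ k, |α k| ≤ 1)
    (u v : ι → ℂ) (θ : ℂ) (hv : ∀ k, ‖v k‖ = ‖u k‖) :
    ‖corrector γ μ α u v θ‖ ≤ ‖θ‖ * ∑ k, ‖u k‖ + |γ| / 2 * δ⁻¹ * (∑ k, ‖u k‖) ^ 2 := by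
  have hterm : ∀ k, ‖(α k : ℂ) * (v k * θ) - γ / 2 * ∑ l, correctorCoeff μ α k l * (v k * u l)‖ ≤
      ‖θ‖ * ‖u k‖ + |γ| / 2 * δ⁻¹ * (‖u k‖ * ∑ l, ‖u l‖) := by
    intro k
    refine (norm_sub_le _ _).trans (add_le_add ?_ ?_)
    · rw [norm_mul, norm_mul, hv, mul_comm ‖u k‖]
      refine mul_le_of_le_one_left (by positivity) ?_
      rw [Complex.norm_real]; exact hα k
    · have : ‖(γ : ℂ) / 2‖ = |γ| / 2 := by
        rw [norm_div, Complex.norm_real, Real.norm_eq_abs]; simp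
      rw [norm_mul, this, mul_assoc, Finset.mul_sum, Finset.mul_sum]
      gcongr
      refine (norm_sum_le _ _).trans (Finset.sum_le_sum fun l _ => ?_)
      rw [norm_mul, norm_mul, hv]
      gcongr
      exact norm_correctorCoeff_le hδ hμ hα k l
  refine (norm_sum_le _ _).trans ((Finset.sum_le_sum fun k _ => hterm k).trans (le_of_eq ?_))
  rw [Finset.sum_add_distrib, ← Finset.mul_sum, ← Finset.mul_sum, ← Finset.sum_mul]
  ring

end Corrector

/-! ### Decay of the corrected energy at one frequency. -/

section Decay

theorem le_add_of_sq_le_four_mul {z a b : ℝ} (ha : 0 ≤ a) (hb : 0 ≤ b) (h : z ^ 2 ≤ 4 * (a * b)) :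
    z ≤ a + b :=
  le_of_sq_le_sq (by nlinarith [sq_nonneg (a - b)]) (by positivity)

variable {ι : Type*} [Fintype ι]

/-- The dissipation inequality for the corrected energy, in terms of the sizes `x = |θ|`,
`Q = ∑ |uₖ|²`, `S = ∑ |uₖ|` and the corrector term `G`. -/
theorem dissipation_le {γ κ α₀ M' N b ρ m x Q S G : ℝ} (hκ : 0 < κ) (hα₀ : 0 < α₀)
    (hM' : 0 ≤ M') (hN : 0 ≤ N) (hb : 0 < b) (hρ : 0 < ρ) (hm : 0 ≤ m) (hm1 : m ≤ 1)
    (hmρ : m ≤ ρ ^ 2) (hQ : 0 ≤ Q) (hS : S ^ 2 ≤ N * Q)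
    (hbκ : b * (2 * (N / α₀ ^ 2) * M' ^ 2 + N * γ ^ 2 + 2 * (N / α₀ ^ 2) * κ ^ 2) ≤ 2 * κ)
    (hG : γ ^ 2 / 2 * α₀ ^ 2 * Q - |γ| * ((M' + κ * ρ) * (x * S) + N * |γ| * x ^ 2) ≤ G) :
    -4 * κ * ρ ^ 2 * x ^ 2 - b * m * G ≤ -(min κ (b * γ ^ 2 * α₀ ^ 2 / 4) * m) * (Q + 2 * x ^ 2) := by
  set C₃ := N / α₀ ^ 2 with hC₃
  have hC₃0 : 0 ≤ C₃ := by positivity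
  -- Half of the coercive term in `Q` is spent on the mixed term `x S`.
  have young : |γ| * ((M' + κ * ρ) * (x * S)) ≤
      γ ^ 2 * α₀ ^ 2 / 4 * Q + C₃ * (M' + κ * ρ) ^ 2 * x ^ 2 := by
    refine le_add_of_sq_le_four_mul (by positivity) (by positivity) ?_
    have e1 : (|γ| * ((M' + κ * ρ) * (x * S))) ^ 2 = γ ^ 2 * (M' + κ * ρ) ^ 2 * x ^ 2 * S ^ 2 := by
      rw [← sq_abs γ]; ring
    have e2 : 4 * (γ ^ 2 * α₀ ^ 2 / 4 * Q * (C₃ * (M' + κ * ρ) ^ 2 * x ^ 2)) =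
        γ ^ 2 * (M' + κ * ρ) ^ 2 * x ^ 2 * (N * Q) := by
      rw [hC₃]; field_simp
    rw [e1, e2]
    gcongr
  have hG' : γ ^ 2 * α₀ ^ 2 / 4 * Q - (C₃ * (M' + κ * ρ) ^ 2 + N * γ ^ 2) * x ^ 2 ≤ G := by
    have : |γ| * (N * |γ| * x ^ 2) = N * γ ^ 2 * x ^ 2 := by rw [← sq_abs γ]; ring
    nlinarith
  -- `m ≤ ρ²` handles the constant part, which matters at low frequency; `m ≤ 1` handles the part
  -- growing like `ρ²`.
  have hP : m * (C₃ * (M' + κ * ρ) ^ 2 + N * γ ^ 2) ≤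
      ρ ^ 2 * (2 * C₃ * M' ^ 2 + N * γ ^ 2 + 2 * C₃ * κ ^ 2) := by
    have h1 : (M' + κ * ρ) ^ 2 ≤ 2 * M' ^ 2 + 2 * κ ^ 2 * ρ ^ 2 := by
      nlinarith [sq_nonneg (M' - κ * ρ)]
    calc m * (C₃ * (M' + κ * ρ) ^ 2 + N * γ ^ 2)
        ≤ m * (C₃ * (2 * M' ^ 2 + 2 * κ ^ 2 * ρ ^ 2) + N * γ ^ 2) := by gcongr
      _ = m * (2 * C₃ * M' ^ 2 + N * γ ^ 2) + m * ρ ^ 2 * (2 * C₃ * κ ^ 2) := by ring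
      _ ≤ ρ ^ 2 * (2 * C₃ * M' ^ 2 + N * γ ^ 2) + 1 * ρ ^ 2 * (2 * C₃ * κ ^ 2) := by gcongr
      _ = _ := by ring
  have hx2 : b * m * ((C₃ * (M' + κ * ρ) ^ 2 + N * γ ^ 2) * x ^ 2) ≤ 2 * κ * ρ ^ 2 * x ^ 2 := by
    calc b * m * ((C₃ * (M' + κ * ρ) ^ 2 + N * γ ^ 2) * x ^ 2)
        = b * (m * (C₃ * (M' + κ * ρ) ^ 2 + N * γ ^ 2)) * x ^ 2 := by ring
      _ ≤ b * (ρ ^ 2 * (2 * C₃ * M' ^ 2 + N * γ ^ 2 + 2 * C₃ * κ ^ 2)) * x ^ 2 := by gcongr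
      _ = b * (2 * C₃ * M' ^ 2 + N * γ ^ 2 + 2 * C₃ * κ ^ 2) * ρ ^ 2 * x ^ 2 := by ring
      _ ≤ 2 * κ * ρ ^ 2 * x ^ 2 := by gcongr
  have h1 := mul_le_mul_of_nonneg_left hG' (mul_nonneg hb.le hm)
  set c := min κ (b * γ ^ 2 * α₀ ^ 2 / 4)
  have hc0 : 0 ≤ c := le_min hκ.le (by positivity)
  have h2 : c * m * Q ≤ b * m * (γ ^ 2 * α₀ ^ 2 / 4 * Q) := by
    calc c * m * Q ≤ b * γ ^ 2 * α₀ ^ 2 / 4 * m * Q := by gcongr; exact min_le_right _ _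
      _ = _ := by ring
  have h3 : c * m * (2 * x ^ 2) ≤ 2 * κ * ρ ^ 2 * x ^ 2 := by
    calc c * m * (2 * x ^ 2) ≤ κ * ρ ^ 2 * (2 * x ^ 2) := by gcongr; exact min_le_left _ _
      _ = _ := by ring
  linarith

/-- A function with `f' ≤ -λ f` decays exponentially. -/
theorem le_exp_of_hasDerivWithinAt_le {f f' : ℝ → ℝ} {a : ℝ}
    (hf : ∀ t, 0 ≤ t → HasDerivWithinAt f (f' t) (Set.Ici 0) t)
    (hle : ∀ t, 0 ≤ t → f' t ≤ -a * f t) {t : ℝ} (ht : 0 ≤ t) :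
    f t ≤ Real.exp (-a * t) * f 0 := by
  have hd : ∀ s, 0 ≤ s → HasDerivWithinAt (fun s => Real.exp (a * s) * f s)
      (Real.exp (a * s) * a * f s + Real.exp (a * s) * f' s) (Set.Ici 0) s := fun s hs => by
    have h1 : HasDerivAt (fun s => Real.exp (a * s)) (Real.exp (a * s) * a) s := by
      simpa using ((hasDerivAt_id s).const_mul a).exp
    exact h1.hasDerivWithinAt.mul (hf s hs)
  have hanti : AntitoneOn (fun s => Real.exp (a * s) * f s) (Set.Ici 0) := by
    refine antitoneOn_of_hasDerivWithinAt_nonpos (convex_Ici 0)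
      (fun s hs => (hd s hs).continuousWithinAt)
      (fun s hs => (hd s (interior_subset hs)).mono interior_subset) fun s hs => ?_
    have := hle s (interior_subset hs)
    have hp := Real.exp_pos (a * s)
    nlinarith
  have h := hanti Set.self_mem_Ici ht ht
  simp only [mul_zero, Real.exp_zero, one_mul] at h
  calc f t = Real.exp (-a * t) * (Real.exp (a * t) * f t) := by
        rw [← mul_assoc, ← Real.exp_add]; simp
    _ ≤ _ := by gcongr

/-- The weight `2` on the temperature compensates the factor `γ/2` in its equation, so the coupling
terms cancel and only heat loss remains. -/
theorem energy_deriv_identity (a : ι → ℝ) (w : ι → ℝ) (γ d : ℝ)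
    (u v du dv : ι → ℂ) (θ η dθ dη : ℂ)
    (hdu : ∀ k, du k = Complex.I * w k * u k - γ * a k * θ)
    (hdv : ∀ k, dv k = -(Complex.I * w k) * v k - γ * a k * η)
    (hdθ : dθ = γ / 2 * ∑ k, a k * u k - d * θ)
    (hdη : dη = γ / 2 * ∑ k, a k * v k - d * η) :
    ∑ k, (dv k * u k + v k * du k) + 2 * (dη * θ + η * dθ) = -4 * d * (η * θ) := by
  have : ∑ k, (dv k * u k + v k * du k) =
      -γ * (η * ∑ k, a k * u k) - γ * (θ * ∑ k, a k * v k) := by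
    simp only [Finset.mul_sum, ← Finset.sum_sub_distrib]
    refine Finset.sum_congr rfl fun k _ => ?_
    rw [hdu, hdv]; ring
  rw [this, hdθ, hdη]
  ring

set_option maxHeartbeats 1000000 in
/-- Uniform decay of solutions of the hyperbolic-parabolic system at a fixed frequency. -/
theorem exists_energy_decay {γ κ α₀ δ M : ℝ} (hγ : γ ≠ 0) (hκ : 0 < κ) (hα₀ : 0 < α₀)
    (hδ : 0 < δ) (hM : 0 ≤ M) :
    ∃ c : ℝ, 0 < c ∧ ∀ (μ α : ι → ℝ) (ρ : ℝ), 0 < ρ → (∀ k l, k ≠ l → δ ≤ |μ l - μ k|) →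
      (∀ k, |μ k| ≤ M) → (∀ k, α₀ ≤ |α k|) → (∀ k, |α k| ≤ 1) →
      ∀ (u : ℝ → ι → ℂ) (θ : ℝ → ℂ),
      (∀ t, 0 ≤ t → ∀ k, HasDerivWithinAt (fun s => u s k)
        (Complex.I * (ρ * μ k : ℝ) * u t k - γ * (ρ * α k : ℝ) * θ t) (Set.Ici 0) t) →
      (∀ t, 0 ≤ t → HasDerivWithinAt θ
        (γ / 2 * ∑ k, (ρ * α k : ℝ) * u t k - (κ * ρ ^ 2 : ℝ) * θ t) (Set.Ici 0) t) →
      ∀ t, 0 ≤ t → ∑ k, ‖u t k‖ ^ 2 + 2 * ‖θ t‖ ^ 2 ≤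
        3 * Real.exp (-(c * min 1 (ρ ^ 2)) * t) * (∑ k, ‖u 0 k‖ ^ 2 + 2 * ‖θ 0‖ ^ 2) := by
  set N : ℝ := (Fintype.card ι : ℝ) with hN
  have hN0 : 0 ≤ N := Nat.cast_nonneg _
  set M' : ℝ := M + γ ^ 2 * δ⁻¹ * N with hM'
  have hM'0 : 0 ≤ M' := by positivity
  set C₄ : ℝ := 2 * (N / α₀ ^ 2) * M' ^ 2 + N * γ ^ 2 + 2 * (N / α₀ ^ 2) * κ ^ 2 with hC₄
  have hC₄0 : 0 ≤ C₄ := by positivity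
  set CH : ℝ := 1 + (1 + |γ| * δ⁻¹) * N with hCH
  have hCH0 : 0 < CH := by positivity
  -- The first bound lets half the heat dissipation absorb the remainder; the second keeps the
  -- corrector below half the energy.
  set b : ℝ := min (2 * κ / (C₄ + 1)) (1 / (2 * (|γ| + 1) * CH)) with hbdef
  have hb : 0 < b := by positivity
  have hb1 : b * C₄ ≤ 2 * κ := by
    have : b * (C₄ + 1) ≤ 2 * κ := by
      rw [← le_div_iff₀ (by positivity)]; exact min_le_left _ _
    nlinarith
  have hb2 : b * |γ| * CH ≤ 1 / 2 := by
    have : b * (2 * (|γ| + 1) * CH) ≤ 1 := by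
      rw [← le_div_iff₀ (by positivity)]; exact min_le_right _ _
    have hp : 0 < b * CH := by positivity
    nlinarith
  set c₁ : ℝ := min κ (b * γ ^ 2 * α₀ ^ 2 / 4) with hc₁
  have hγ2 : 0 < γ ^ 2 := by positivity
  have hc₁0 : 0 < c₁ := lt_min hκ (by positivity)
  refine ⟨2 / 3 * c₁, by positivity, ?_⟩
  intro μ α ρ hρ hμ hμM hα hα1 u θ hu hθ
  set m : ℝ := min 1 (ρ ^ 2) with hm
  have hm0 : 0 < m := by positivity
  have hm1 : m ≤ 1 := min_le_left _ _
  have hmρ2 : m ≤ ρ ^ 2 := min_le_right _ _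
  have hmρ : m / ρ ≤ 1 := by
    rw [div_le_one hρ]
    rcases le_total ρ 1 with h | h
    · nlinarith
    · linarith
  have hμ0 : ∀ k l, k ≠ l → μ l - μ k ≠ 0 := fun k l h => abs_pos.1 (hδ.trans_le (hμ k l h))
  let v : ℝ → ι → ℂ := fun t k => star (u t k)
  let η : ℝ → ℂ := fun t => star (θ t)
  -- Derivatives are taken with one factor `ρ` removed, so the corrector depends on `μ, α` only and
  -- its bounds are uniform in `ρ`.
  let du : ℝ → ι → ℂ := fun t k => Complex.I * (μ k : ℝ) * u t k - γ * (α k : ℝ) * θ t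
  let dv : ℝ → ι → ℂ := fun t k => -(Complex.I * (μ k : ℝ)) * v t k - γ * (α k : ℝ) * η t
  let dθ : ℝ → ℂ := fun t => γ / 2 * ∑ k, (α k : ℝ) * u t k - (κ * ρ : ℝ) * θ t
  let dη : ℝ → ℂ := fun t => γ / 2 * ∑ k, (α k : ℝ) * v t k - (κ * ρ : ℝ) * η t
  have hdv : ∀ t k, dv t k = star (du t k) := fun t k => by
    simp [dv, du, v, η]
  have hdη : ∀ t, dη t = star (dθ t) := fun t => by
    simp [dη, dθ, v, η]
  have hu' : ∀ t, 0 ≤ t → ∀ k, HasDerivWithinAt (fun s => u s k) (ρ * du t k) (Set.Ici 0) t :=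
    fun t ht k => by
      convert hu t ht k using 1
      simp only [du]; push_cast; ring
  have hθ' : ∀ t, 0 ≤ t → HasDerivWithinAt θ (ρ * dθ t) (Set.Ici 0) t := fun t ht => by
    convert hθ t ht using 1
    simp only [dθ, Finset.mul_sum, mul_sub]
    push_cast
    congr 1
    · exact Finset.sum_congr rfl fun k _ => by ring
    · ring
  have hv' : ∀ t, 0 ≤ t → ∀ k, HasDerivWithinAt (fun s => v s k) (ρ * dv t k) (Set.Ici 0) t :=
    fun t ht k => by
      have := (hu' t ht k).star
      rw [hdv]
      simpa [v] using this
  have hη' : ∀ t, 0 ≤ t → HasDerivWithinAt η (ρ * dη t) (Set.Ici 0) t := fun t ht => by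
    have := (hθ' t ht).star
    rw [hdη]
    simpa [η] using this
  let e : ℝ → ℝ := fun t => ∑ k, ‖u t k‖ ^ 2 + 2 * ‖θ t‖ ^ 2
  let H : ℝ → ℂ := fun t => corrector γ μ α (u t) (v t) (θ t)
  let dH : ℝ → ℂ := fun t => γ / 2 * ∑ k, (α k : ℂ) ^ 2 * (v t k * u t k) +
    correctorRemainder γ (κ * ρ) μ α (u t) (v t) (θ t) (η t)
  have hH : ∀ t, 0 ≤ t → HasDerivWithinAt H (ρ * dH t) (Set.Ici 0) t := fun t ht => by
    have key := corrector_deriv_identity hμ0 γ (κ * ρ) (u t) (v t) (du t) (dv t) (θ t) (η t) (dθ t)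
      (fun _ => rfl) (fun _ => rfl) rfl
    have h1 : HasDerivWithinAt H (∑ k, ((α k : ℂ) * ((ρ * dv t k) * θ t + v t k * (ρ * dθ t)) -
        γ / 2 * ∑ l, correctorCoeff μ α k l * ((ρ * dv t k) * u t l + v t k * (ρ * du t l))))
        (Set.Ici 0) t := by
      refine HasDerivWithinAt.fun_sum fun k _ => HasDerivWithinAt.fun_sub ?_ ?_
      · exact ((hv' t ht k).mul (hθ' t ht)).const_mul _
      · refine HasDerivWithinAt.const_mul _ (HasDerivWithinAt.fun_sum fun l _ => ?_)
        exact ((hv' t ht k).mul (hu' t ht l)).const_mul _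
    convert h1 using 1
    rw [show dH t = _ from key.symm, Finset.mul_sum]
    refine Finset.sum_congr rfl fun k _ => ?_
    rw [mul_sub]
    congr 1
    · ring
    · rw [mul_left_comm, Finset.mul_sum]
      congr 1
      exact Finset.sum_congr rfl fun l _ => by ring
  have hE : ∀ t, 0 ≤ t → HasDerivWithinAt (fun t => ∑ k, v t k * u t k + 2 * (η t * θ t))
      (ρ * (-4 * (κ * ρ : ℝ) * (η t * θ t))) (Set.Ici 0) t := fun t ht => by
    have key := energy_deriv_identity α μ γ (κ * ρ) (u t) (v t) (du t) (dv t) (θ t) (η t) (dθ t)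
      (dη t) (fun _ => rfl) (fun _ => rfl) rfl rfl
    have h1 : HasDerivWithinAt (fun t => ∑ k, v t k * u t k + 2 * (η t * θ t))
        (∑ k, ((ρ * dv t k) * u t k + v t k * (ρ * du t k)) +
          2 * ((ρ * dη t) * θ t + η t * (ρ * dθ t))) (Set.Ici 0) t := by
      refine HasDerivWithinAt.fun_add (HasDerivWithinAt.fun_sum fun k _ => ?_) ?_
      · exact (hv' t ht k).mul (hu' t ht k)
      · exact ((hη' t ht).mul (hθ' t ht)).const_mul _
    convert h1 using 1
    rw [← key, mul_add, Finset.mul_sum]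
    congr 1
    · exact Finset.sum_congr rfl fun k _ => by ring
    · ring
  have hvu : ∀ t k, v t k * u t k = ((‖u t k‖ ^ 2 : ℝ) : ℂ) := fun t k => by
    simp only [v]
    rw [Complex.star_def, Complex.conj_mul']; push_cast; rfl
  have hηθ : ∀ t, η t * θ t = ((‖θ t‖ ^ 2 : ℝ) : ℂ) := fun t => by
    simp only [η]
    rw [Complex.star_def, Complex.conj_mul']; push_cast; rfl
  have he : ∀ t, ∑ k, v t k * u t k + 2 * (η t * θ t) = ((e t : ℝ) : ℂ) := fun t => by
    simp only [hvu, hηθ, e]; push_cast; rfl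
  -- Differentiating `H` gives a factor `ρ`, so the weight `m/ρ` yields dissipation of size `m =
  -- min(1, ρ²)`. The extra `γ` makes the coercive term `γ²/2`, whatever the sign of `γ`.
  let f : ℝ → ℝ := fun t => e t - b * (m / ρ) * (γ * (H t).re)
  have hf : ∀ t, 0 ≤ t → HasDerivWithinAt f
      (-4 * κ * ρ ^ 2 * ‖θ t‖ ^ 2 - b * m * (γ * (dH t).re)) (Set.Ici 0) t := fun t ht => by
    have h1 := Complex.reCLM.hasFDerivAt.comp_hasDerivWithinAt t (hE t ht)
    have h2 := Complex.reCLM.hasFDerivAt.comp_hasDerivWithinAt t (hH t ht)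
    have h3 := h1.sub ((h2.const_mul γ).const_mul (b * (m / ρ)))
    have hfe : f = fun t => (Complex.reCLM ∘ fun t => ∑ k, v t k * u t k + 2 * (η t * θ t)) t -
        b * (m / ρ) * (γ * (Complex.reCLM ∘ H) t) := by
      funext s
      simp only [Function.comp_apply, he, f, Complex.reCLM_apply, Complex.ofReal_re]
    rw [hfe]
    refine h3.congr_deriv ?_
    simp only [Complex.reCLM_apply, hηθ]
    have r1 : ((ρ : ℂ) * (-4 * (κ * ρ : ℝ) * (‖θ t‖ ^ 2 : ℝ))).re =
        -4 * κ * ρ ^ 2 * ‖θ t‖ ^ 2 := by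
      rw [show ((ρ : ℂ) * (-4 * (κ * ρ : ℝ) * (‖θ t‖ ^ 2 : ℝ))) =
        ((-4 * κ * ρ ^ 2 * ‖θ t‖ ^ 2 : ℝ) : ℂ) by push_cast; ring, Complex.ofReal_re]
    rw [r1, Complex.re_ofReal_mul]
    field_simp
  have hS : ∀ t, (∑ k, ‖u t k‖) ^ 2 ≤ N * ∑ k, ‖u t k‖ ^ 2 := fun t => by
    simpa [hN] using sq_sum_le_card_mul_sum_sq (s := Finset.univ) (f := fun k => ‖u t k‖)
  have hQ0 : ∀ t, 0 ≤ ∑ k, ‖u t k‖ ^ 2 := fun t => Finset.sum_nonneg fun k _ => by positivity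
  have hvn : ∀ t k, ‖v t k‖ = ‖u t k‖ := fun t k => norm_star _
  have hηn : ∀ t, ‖η t‖ = ‖θ t‖ := fun t => norm_star _
  have hGbound : ∀ t, γ ^ 2 / 2 * α₀ ^ 2 * ∑ k, ‖u t k‖ ^ 2 - |γ| * ((M' + κ * ρ) *
      (‖θ t‖ * ∑ k, ‖u t k‖) + N * |γ| * ‖θ t‖ ^ 2) ≤ γ * (dH t).re := fun t => by
    have hR := norm_correctorRemainder_le (γ := γ) hδ (by positivity : 0 ≤ κ * ρ) hμ hμM hα1
      (u t) (v t) (θ t) (η t) (hvn t) (hηn t)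
    set R := correctorRemainder γ (κ * ρ) μ α (u t) (v t) (θ t) (η t) with hRdef
    have hre : (dH t).re = γ / 2 * ∑ k, α k ^ 2 * ‖u t k‖ ^ 2 + R.re := by
      have : dH t = ((γ / 2 * ∑ k, α k ^ 2 * ‖u t k‖ ^ 2 : ℝ) : ℂ) + R := by
        simp only [dH, hvu]; push_cast; rfl
      rw [this, Complex.add_re, Complex.ofReal_re]
    have h1 : α₀ ^ 2 * ∑ k, ‖u t k‖ ^ 2 ≤ ∑ k, α k ^ 2 * ‖u t k‖ ^ 2 := by
      rw [Finset.mul_sum]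
      refine Finset.sum_le_sum fun k _ => ?_
      rw [← sq_abs (α k)]
      gcongr
      exact hα k
    have h2 : -(|γ| * ‖R‖) ≤ γ * R.re := by
      have : |γ * R.re| ≤ |γ| * ‖R‖ := by
        rw [abs_mul]; gcongr; exact Complex.abs_re_le_norm R
      exact (abs_le.1 this).1
    have h3 := mul_le_mul_of_nonneg_left hR (abs_nonneg γ)
    have h4 := mul_le_mul_of_nonneg_left h1 (by positivity : 0 ≤ γ ^ 2 / 2)
    have e1 : M + κ * ρ + γ ^ 2 * δ⁻¹ * N = M' + κ * ρ := by rw [hM']; ring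
    rw [← hN, e1] at h3
    rw [hre]
    linarith
  have hfle : ∀ t, 0 ≤ t → -4 * κ * ρ ^ 2 * ‖θ t‖ ^ 2 - b * m * (γ * (dH t).re) ≤
      -(c₁ * m) * e t := fun t ht =>
    dissipation_le hκ hα₀ hM'0 hN0 hb hρ hm0.le hm1 hmρ2 (hQ0 t) (hS t) hb1
      (hGbound t)
  have hcmp : ∀ t, |b * (m / ρ) * (γ * (H t).re)| ≤ e t / 2 := fun t => by
    have hHn := norm_corrector_le (γ := γ) hδ hμ hα1 (u t) (v t) (θ t) (hvn t)
    have h1 : ‖H t‖ ≤ CH * e t := by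
      have hs := hS t
      have hQ := hQ0 t
      set S := ∑ k, ‖u t k‖
      set Q := ∑ k, ‖u t k‖ ^ 2 with hQd
      have g1 : ‖θ t‖ * S ≤ ‖θ t‖ ^ 2 + S ^ 2 := by
        nlinarith [sq_nonneg (‖θ t‖ - S), sq_nonneg (‖θ t‖), sq_nonneg S]
      have g2 : |γ| / 2 * δ⁻¹ * S ^ 2 ≤ |γ| * δ⁻¹ * S ^ 2 := by
        have : 0 ≤ |γ| * δ⁻¹ * S ^ 2 := by positivity
        linarith
      have g3 : (1 + |γ| * δ⁻¹) * S ^ 2 ≤ (1 + |γ| * δ⁻¹) * (N * Q) := by gcongr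
      have g4 : ‖H t‖ ≤ ‖θ t‖ ^ 2 + (1 + |γ| * δ⁻¹) * (N * Q) := by
        calc ‖H t‖ ≤ _ := hHn
          _ ≤ _ := by linarith
      have g5 : CH * e t = Q + 2 * ‖θ t‖ ^ 2 + (1 + |γ| * δ⁻¹) * (N * Q) +
          (1 + |γ| * δ⁻¹) * N * (2 * ‖θ t‖ ^ 2) := by
        simp only [hCH, e, ← hQd]; ring
      have g6 : 0 ≤ (1 + |γ| * δ⁻¹) * N * (2 * ‖θ t‖ ^ 2) := by positivity
      have g7 := sq_nonneg ‖θ t‖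
      linarith
    have he0 : 0 ≤ e t := add_nonneg (hQ0 t) (by positivity)
    rw [abs_mul, abs_mul γ, abs_of_nonneg (by positivity : 0 ≤ b * (m / ρ))]
    calc b * (m / ρ) * (|γ| * |(H t).re|) ≤ b * 1 * (|γ| * (CH * e t)) := by
          gcongr
          exact (Complex.abs_re_le_norm _).trans h1
      _ = b * |γ| * CH * e t := by ring
      _ ≤ 1 / 2 * e t := by gcongr
      _ = e t / 2 := by ring
  intro t ht
  -- From `f' ≤ -c₁ m e` and `f ≤ (3/2) e` comes the rate `(2/3) c₁ m`; `e/2 ≤ f` then gives the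
  -- constant `3`.
  have hgron := le_exp_of_hasDerivWithinAt_le (a := 2 / 3 * c₁ * m) hf (fun s hs => by
    refine (hfle s hs).trans ?_
    have h1 := (abs_le.1 (hcmp s)).1
    have h2 : f s ≤ 3 / 2 * e s := by simp only [f]; linarith
    have : 0 < c₁ * m := by positivity
    nlinarith) ht
  have h0 : f 0 ≤ 3 / 2 * e 0 := by
    have := (abs_le.1 (hcmp 0)).1
    simp only [f]; linarith
  have h1 : e t / 2 ≤ f t := by
    have := (abs_le.1 (hcmp t)).2
    simp only [f]; linarith
  have h2 := mul_le_mul_of_nonneg_left h0 (Real.exp_pos (-(2 / 3 * c₁ * m) * t)).le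
  calc e t ≤ 2 * (Real.exp (-(2 / 3 * c₁ * m) * t) * (3 / 2 * e 0)) := by linarith
    _ = _ := by simp only [e]; ring

end Decay

/-! ### Uniform bounds on compact sets for finite families. -/

section Uniform

variable {X ι : Type*} [TopologicalSpace X] [Finite ι]

theorem exists_uniform_pos_le {K : Set X} (hK : IsCompact K) (f : ι → X → ℝ)
    (hf : ∀ i, ContinuousOn (f i) K) (hpos : ∀ i, ∀ x ∈ K, 0 < f i x) :
    ∃ δ : ℝ, 0 < δ ∧ ∀ i, ∀ x ∈ K, δ ≤ f i x := by
  have h : ∀ᶠ δ in nhdsWithin (0 : ℝ) (Set.Ioi 0), ∀ i, ∀ x ∈ K, δ ≤ f i x := by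
    rw [Filter.eventually_all]
    intro i
    obtain ⟨a, ha, h⟩ := hK.exists_forall_le' (hf i) (hpos i)
    filter_upwards [Ioo_mem_nhdsGT ha] with δ hδ x hx
    exact hδ.2.le.trans (h x hx)
  obtain ⟨δ, h, hδ⟩ := (h.and self_mem_nhdsWithin).exists
  exact ⟨δ, hδ, h⟩

theorem exists_uniform_le {K : Set X} (hK : IsCompact K) (f : ι → X → ℝ)
    (hf : ∀ i, ContinuousOn (f i) K) :
    ∃ M : ℝ, 0 ≤ M ∧ ∀ i, ∀ x ∈ K, f i x ≤ M := by
  have h : ∀ᶠ M in (Filter.atTop : Filter ℝ), ∀ i, ∀ x ∈ K, f i x ≤ M := by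
    rw [Filter.eventually_all]
    intro i
    obtain ⟨C, hC⟩ := hK.bddAbove_image (hf i)
    filter_upwards [Filter.eventually_ge_atTop C] with M hM x hx
    exact (hC (Set.mem_image_of_mem _ hx)).trans hM
  obtain ⟨M, h, hM⟩ := (h.and (Filter.eventually_ge_atTop 0)).exists
  exact ⟨M, hM, h⟩

end Uniform

/-! ### Couplings in polar form. -/

section Coupling

variable {n : ℕ}

/-- The couplings `rⱼ(η) · η` of the elastic modes. -/
def modeCoupling (r : Fin n → Sph n → Space n) (η : Sph n) (i : Fin n ⊕ Fin n) : ℝ :=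
  inner ℝ (r (Sum.elim id id i) η) (η : Space n)

theorem coupling_eq (r : Fin n → Sph n → Space n) (ξ : Space n) (h : ξ ≠ 0)
    (i : Fin n ⊕ Fin n) :
    coupling r (Sum.elim id id i) ξ h = ‖ξ‖ * modeCoupling r (direction ξ h) i := by
  have : ξ = ‖ξ‖ • (direction ξ h : Space n) := by
    rw [direction, smul_smul, mul_inv_cancel₀ (norm_ne_zero_iff.2 h), one_smul]
  rw [coupling, modeCoupling, ← inner_smul_right, ← this]

end Coupling

/-! ### Elastic eigenvalues and the flow of `B(ξ)`. -/

section Eigenvalues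

variable {n : ℕ} [Fact (3 ≤ n)] (A : ElasticSymbol n)

theorem exists_eigenvalue_eq (η : Sph n) : ∃ e : Fin n ≃ Fin n, ∀ j,
    eigenvalue A j η = (A.posDef η).isHermitian.eigenvalues (e j) := by
  let φ : Fin (Fintype.card (Fin n)) ≃ Fin n :=
    Fintype.equivOfCardEq (Fintype.card_fin _)
  refine ⟨(Fin.revPerm.trans (finCongr (Fintype.card_fin n).symm)).trans φ, fun j => ?_⟩
  simp [eigenvalue, Matrix.IsHermitian.eigenvalues, φ]

theorem eigenvalue_pos (j : Fin n) (η : Sph n) : 0 < eigenvalue A j η := by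
  obtain ⟨e, he⟩ := exists_eigenvalue_eq A η
  rw [he]
  exact (A.posDef η).eigenvalues_pos _

theorem eigenvalue_injective {η : Sph n} (h : IsNondegenerate A η) :
    Function.Injective fun j => eigenvalue A j η := by
  obtain ⟨e, he⟩ := exists_eigenvalue_eq A η
  have hinj : Function.Injective (A.posDef η).isHermitian.eigenvalues := by
    classical
    rw [IsNondegenerate, (A.posDef η).isHermitian.spectrum_real_eq_range_eigenvalues,
      ← Set.image_univ, ← Finset.coe_univ, ← Finset.coe_image, Set.ncard_coe_finset] at h
    have h' : (Finset.univ.image (A.posDef η).isHermitian.eigenvalues).card =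
        (Finset.univ : Finset (Fin n)).card := by
      rw [h]; simp
    rw [Finset.card_image_iff] at h'
    simpa [Set.injOn_univ] using h'
  intro i j hij
  simp only [he] at hij
  exact e.injective (hinj hij)

variable {A} in
theorem IsEigenframe.continuousOn {U : Set (Sph n)} {r : Fin n → Sph n → Space n}
    (hr : IsEigenframe A U r) (j : Fin n) : ContinuousOn (r j) U :=
  (hr.smooth j).continuousOn

variable {A} in
-- The eigenvalue equals `r_j · A r_j` for the continuous unit eigenvector `r_j`, so no perturbation
-- theory is needed.
theorem IsEigenframe.continuousOn_eigenvalue {U : Set (Sph n)} {r : Fin n → Sph n → Space n}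
    (hr : IsEigenframe A U r) (j : Fin n) : ContinuousOn (eigenvalue A j) U := by
  have h : ∀ η ∈ U, eigenvalue A j η =
      ∑ i, (∑ k, A.toFun η i k * r j η k) * r j η i := by
    intro η hη
    have h1 : inner ℝ (r j η) (Matrix.toEuclideanLin (A.toFun η) (r j η)) = eigenvalue A j η := by
      rw [hr.eigen j η hη, inner_smul_right, real_inner_self_eq_norm_sq, hr.norm_eq_one j η hη]
      simp
    rw [← h1, PiLp.inner_apply]
    simp [Matrix.toLpLin_apply, Matrix.mulVec, dotProduct]
  refine ContinuousOn.congr ?_ h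
  have hc : ∀ k, ContinuousOn (fun η => r j η k) U := fun k =>
    (EuclideanSpace.proj (𝕜 := ℝ) k).continuous.comp_continuousOn (hr.continuousOn j)
  have hA : ∀ i k, Continuous fun η => A.toFun η i k := fun i k => (A.analytic i k).continuous
  exact continuousOn_finsetSum _ fun i _ =>
    (continuousOn_finsetSum _ fun k _ => (hA i k).continuousOn.mul (hc k)).mul (hc i)

/-- The frequencies `±√ϰⱼ` of the elastic modes. -/
def modeFreq (η : Sph n) : Fin n ⊕ Fin n → ℝ :=
  Sum.elim (fun j => √(eigenvalue A j η)) (fun j => -√(eigenvalue A j η))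

/-- Positivity of the eigenvalues separates the two signs; non-degeneracy separates modes of equal
sign. -/
theorem modeFreq_injective {η : Sph n} (h : IsNondegenerate A η) :
    Function.Injective (modeFreq A η) := by
  have hpos : ∀ j, 0 < √(eigenvalue A j η) := fun j => Real.sqrt_pos.2 (eigenvalue_pos A j η)
  have hinj : ∀ i j, √(eigenvalue A i η) = √(eigenvalue A j η) → i = j := fun i j hij =>
    eigenvalue_injective A h
      ((Real.sqrt_inj (eigenvalue_pos A i η).le (eigenvalue_pos A j η).le).1 hij)
  rintro (i | i) (j | j) hij <;> simp only [modeFreq, Sum.elim_inl, Sum.elim_inr] at hij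
  · rw [hinj i j hij]
  · linarith [hpos i, hpos j]
  · linarith [hpos i, hpos j]
  · rw [hinj i j (neg_injective hij)]

variable {A} in
/-- Quantitative non-degeneracy on a compact set of parabolic directions. -/
theorem exists_uniform_constants {U K : Set (Sph n)} {r : Fin n → Sph n → Space n}
    (hr : IsEigenframe A U r) (hK : IsCompact K) (hKU : K ⊆ U)
    (hpar : ∀ η ∈ K, IsParabolic A r η) :
    ∃ δ α₀ M : ℝ, 0 < δ ∧ 0 < α₀ ∧ 0 ≤ M ∧ ∀ η ∈ K,
      (∀ k l, k ≠ l → δ ≤ |modeFreq A η l - modeFreq A η k|) ∧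
      (∀ k, |modeFreq A η k| ≤ M) ∧ (∀ k, α₀ ≤ |modeCoupling r η k|) ∧
      (∀ k, |modeCoupling r η k| ≤ 1) := by
  have hfreq : ∀ k, ContinuousOn (fun η => modeFreq A η k) K := by
    rintro (j | j) <;> simp only [modeFreq, Sum.elim_inl, Sum.elim_inr]
    · exact ((hr.continuousOn_eigenvalue j).mono hKU).sqrt
    · exact ((hr.continuousOn_eigenvalue j).mono hKU).sqrt.neg
  have hcoup : ∀ k, ContinuousOn (fun η => modeCoupling r η k) K := fun k =>
    ((hr.continuousOn _).mono hKU).inner continuous_subtype_val.continuousOn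
  obtain ⟨δ, hδ, h1⟩ := exists_uniform_pos_le hK
    (fun (p : {p : (Fin n ⊕ Fin n) × (Fin n ⊕ Fin n) // p.1 ≠ p.2}) η =>
      |modeFreq A η p.1.2 - modeFreq A η p.1.1|)
    (fun p => ((hfreq _).sub (hfreq _)).abs)
    (fun p η hη => abs_pos.2 (sub_ne_zero.2 fun h =>
      p.2 (modeFreq_injective A (hpar η hη).1 h).symm))
  obtain ⟨α₀, hα₀, h2⟩ := exists_uniform_pos_le hK (fun k η => |modeCoupling r η k|)
    (fun k => (hcoup k).abs) (fun k η hη => abs_pos.2 ((hpar η hη).2 _))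
  obtain ⟨M, hM, h3⟩ := exists_uniform_le hK (fun k η => |modeFreq A η k|)
    (fun k => (hfreq k).abs)
  refine ⟨δ, α₀, M, hδ, hα₀, hM, fun η hη => ⟨fun k l hkl => h1 ⟨(k, l), hkl⟩ η hη,
    fun k => h3 k η hη, fun k => h2 k η hη, fun k => ?_⟩⟩
  refine (abs_real_inner_le_norm _ _).trans ?_
  rw [hr.norm_eq_one _ η (hKU hη), norm_eq_of_mem_sphere, one_mul]

theorem omega_eq (ξ : Space n) (h : ξ ≠ 0) (j : Fin n) :
    omega A j ξ h = ‖ξ‖ * modeFreq A (direction ξ h) (Sum.inl j) := rfl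

theorem symbolB_apply_mode (κ γ : ℝ) (r : Fin n → Sph n → Space n) (ξ : Space n) (h : ξ ≠ 0)
    (w : State n) (k : Fin n ⊕ Fin n) :
    (Complex.I • Matrix.toEuclideanLin (symbolB A κ γ r ξ h) w) (Sum.inl k) =
      Complex.I * (‖ξ‖ * modeFreq A (direction ξ h) k : ℝ) * w (Sum.inl k) -
        γ * (‖ξ‖ * modeCoupling r (direction ξ h) k : ℝ) * w (Sum.inr ()) := by
  have hI := Complex.I_mul_I
  rw [PiLp.smul_apply, Matrix.toLpLin_apply, ← coupling_eq]
  simp only [smul_eq_mul, Matrix.mulVec, dotProduct, Fintype.sum_sum_type, symbolB]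
  rcases k with j | j
  · simp [Matrix.diagonal_apply, omega_eq, modeFreq]
    linear_combination (γ * coupling r j ξ h * w (Sum.inr ())) * hI
  · simp [Matrix.diagonal_apply, omega_eq, modeFreq]
    linear_combination (γ * coupling r j ξ h * w (Sum.inr ())) * hI

theorem symbolB_apply_temp (κ γ : ℝ) (r : Fin n → Sph n → Space n) (ξ : Space n) (h : ξ ≠ 0)
    (w : State n) :
    (Complex.I • Matrix.toEuclideanLin (symbolB A κ γ r ξ h) w) (Sum.inr ()) =
      γ / 2 * ∑ k, (‖ξ‖ * modeCoupling r (direction ξ h) k : ℝ) * w (Sum.inl k) -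
        (κ * ‖ξ‖ ^ 2 : ℝ) * w (Sum.inr ()) := by
  have hI := Complex.I_mul_I
  rw [PiLp.smul_apply, Matrix.toLpLin_apply]
  simp only [← coupling_eq, smul_eq_mul, Matrix.mulVec, dotProduct, symbolB]
  rw [Fintype.sum_sum_type]
  simp only [Matrix.fromBlocks_apply₂₁, Matrix.fromBlocks_apply₂₂, Matrix.of_apply, mul_assoc,
    neg_mul, Finset.sum_neg_distrib, ← Finset.mul_sum, Finset.univ_unique, Finset.sum_singleton]
  push_cast
  have e : ∀ S : ℂ, Complex.I * (-(Complex.I * γ / 2 * S) +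
      Complex.I * (κ * (‖ξ‖ ^ 2 * w (Sum.inr ())))) =
      γ / 2 * S - κ * (‖ξ‖ ^ 2 * w (Sum.inr ())) := fun S => by
    linear_combination (-(γ / 2 * S) + κ * (‖ξ‖ ^ 2 * w (Sum.inr ()))) * hI
  refine (e _).trans ?_
  rw [mul_assoc]

variable {A} in
/-- Pointwise decay of the flow of `B(ξ)` over a compact set of parabolic directions. -/
theorem exists_flow_decay {κ γ : ℝ} (hκ : 0 < κ) (hγ : γ ≠ 0) {U K : Set (Sph n)}
    {r : Fin n → Sph n → Space n} (hr : IsEigenframe A U r) (hK : IsCompact K) (hKU : K ⊆ U)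
    (hpar : ∀ η ∈ K, IsParabolic A r η) :
    ∃ c : ℝ, 0 < c ∧ ∀ (ξ : Space n) (h : ξ ≠ 0), direction ξ h ∈ K → ∀ w : ℝ → State n,
      (∀ t, 0 ≤ t → HasDerivWithinAt w
        (Complex.I • Matrix.toEuclideanLin (symbolB A κ γ r ξ h) (w t)) (Set.Ici 0) t) →
      ∀ t, 0 ≤ t → ‖w t‖ ≤ 3 * Real.exp (-(c * min 1 (‖ξ‖ ^ 2)) * t) * ‖w 0‖ := by
  obtain ⟨δ, α₀, M, hδ, hα₀, hM, hunif⟩ := exists_uniform_constants hr hK hKU hpar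
  obtain ⟨c, hc, hdecay⟩ := exists_energy_decay (ι := Fin n ⊕ Fin n) hγ hκ hα₀ hδ hM
  -- The energy is quadratic, so its rate is halved for the norm.
  refine ⟨c / 2, by positivity, fun ξ h hξ w hw t ht => ?_⟩
  obtain ⟨h1, h2, h3, h4⟩ := hunif _ hξ
  have hcomp : ∀ i t, 0 ≤ t → HasDerivWithinAt (fun s => w s i)
      ((Complex.I • Matrix.toEuclideanLin (symbolB A κ γ r ξ h) (w t)) i) (Set.Ici 0) t :=
    fun i t ht => (EuclideanSpace.proj (𝕜 := ℂ) i).restrictScalars ℝ |>.hasFDerivAt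
      |>.comp_hasDerivWithinAt t (hw t ht)
  have hE := hdecay (modeFreq A (direction ξ h)) (modeCoupling r (direction ξ h)) ‖ξ‖
    (norm_pos_iff.2 h) h1 h2 h3 h4 (fun t k => w t (Sum.inl k)) (fun t => w t (Sum.inr ()))
    (fun t ht k => by rw [← symbolB_apply_mode]; exact hcomp _ t ht)
    (fun t ht => by rw [← symbolB_apply_temp A]; exact hcomp _ t ht) t ht
  have hn : ∀ s, ‖w s‖ ^ 2 = ∑ k, ‖w s (Sum.inl k)‖ ^ 2 + ‖w s (Sum.inr ())‖ ^ 2 := fun s => by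
    rw [EuclideanSpace.norm_sq_eq, Fintype.sum_sum_type]; simp
  have hQ : ∀ s, 0 ≤ ∑ k, ‖w s (Sum.inl k)‖ ^ 2 := fun s =>
    Finset.sum_nonneg fun k _ => by positivity
  set m := min 1 (‖ξ‖ ^ 2)
  have hexp : Real.exp (-(c * m) * t) = Real.exp (-(c / 2 * m) * t) ^ 2 := by
    rw [← Real.exp_nat_mul]; congr 1; push_cast; ring
  -- The weight `2` on the temperature costs a factor `2`, so the squared constant is `6 ≤ 3²`.
  refine le_of_sq_le_sq ?_ (by positivity)
  have hp := Real.exp_pos (-(c * m) * t)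
  have h0 : ∑ k, ‖w 0 (Sum.inl k)‖ ^ 2 + 2 * ‖w 0 (Sum.inr ())‖ ^ 2 ≤ 2 * ‖w 0‖ ^ 2 := by
    rw [hn 0]; linarith [hQ 0]
  have h0' := mul_le_mul_of_nonneg_left h0 hp.le
  have hw0 : 0 ≤ Real.exp (-(c * m) * t) * ‖w 0‖ ^ 2 := by positivity
  rw [mul_pow, mul_pow, ← hexp, hn t]
  linarith [sq_nonneg ‖w t (Sum.inr ())‖]

end Eigenvalues

/-! ### Homogeneous symbols and pointwise decay of solutions. -/

section Multipliers

variable {n : ℕ}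

theorem continuousOn_homExt {ψ : Sph n → ℂ} (hψ : Continuous ψ) :
    ContinuousOn (homExt ψ) {0}ᶜ := by
  rw [continuousOn_iff_continuous_domRestrict]
  have : Set.domRestrict {0}ᶜ (homExt ψ) = fun ξ : ({0}ᶜ : Set (Space n)) =>
      ψ (direction ξ.1 ξ.2) := by
    funext ξ
    exact dif_pos ξ.2
  rw [this]
  refine hψ.comp (Continuous.subtype_mk ?_ _)
  exact (continuous_subtype_val.norm.inv₀ fun ξ => norm_ne_zero_iff.2 ξ.2).smul
    continuous_subtype_val

theorem measurable_homExt {ψ : Sph n → ℂ} (hψ : Continuous ψ) : Measurable (homExt ψ) :=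
  measurable_of_continuousOn_compl_singleton 0 (continuousOn_homExt hψ)

theorem exists_norm_homExt_le {ψ : Sph n → ℂ} (hψ : Continuous ψ) :
    ∃ B : ℝ, 0 < B ∧ ∀ ξ, ‖homExt ψ ξ‖ ≤ B := by
  obtain ⟨B, hB⟩ := isCompact_univ.exists_bound_of_continuousOn hψ.continuousOn
  refine ⟨max B 1, by positivity, fun ξ => ?_⟩
  by_cases h : ξ ≠ 0
  · rw [homExt, dif_pos h]
    exact (hB _ (Set.mem_univ _)).trans (le_max_left _ _)
  · rw [homExt, dif_neg h, norm_zero]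
    positivity

variable [Fact (3 ≤ n)] {A : ElasticSymbol n}

/-- Pointwise decay of the Fourier transform of a solution in the directions of `K`. -/
theorem exists_solution_decay {κ γ : ℝ} (hκ : 0 < κ) (hγ : γ ≠ 0) {U K : Set (Sph n)}
    {r : Fin n → Sph n → Space n} (hr : IsEigenframe A U r) (hK : IsCompact K) (hKU : K ⊆ U)
    (hpar : ∀ η ∈ K, IsParabolic A r η) {ψ' : Sph n → ℂ} (hψ' : Continuous ψ')
    (hone : ∀ η ∈ K, ψ' η = 1) :
    ∃ c : ℝ, 0 < c ∧ ∀ (V₀ : 𝓢(Space n, State n)) (V : ℝ → L2 n),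
      IsSolution A κ γ r ψ' V₀ V → ∀ t, 0 ≤ t → ∀ᵐ k : Space n,
        ∀ h : (2 * Real.pi) • k ≠ 0, direction ((2 * Real.pi) • k) h ∈ K →
        ‖(𝓕 (V t) : L2 n) k‖ ≤ 3 * Real.exp (-(c * min 1 (‖(2 * Real.pi) • k‖ ^ 2)) * t) *
          ‖(𝓕 V₀ : 𝓢(Space n, State n)) k‖ := by
  obtain ⟨c, hc, hflow⟩ := exists_flow_decay hκ hγ hr hK hKU hpar
  refine ⟨c, hc, fun V₀ V ⟨hV0, W, hW, _, hode⟩ t ht => ?_⟩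
  have h2π : (2 * Real.pi) ≠ 0 := by positivity
  have hq := Measure.quasiMeasurePreserving_smul (volume : Measure (Space n)) h2π
  obtain ⟨B, -, hB⟩ := exists_norm_homExt_le hψ'
  -- The initial value carries the factor `ψ'`, which equals `1` on `K`; there the data are exactly
  -- `V̂₀`.
  have hF0 := fourier_multiplier (measurable_homExt hψ') hB (V₀.toLp 2 : L2 n)
  rw [← hV0, SchwartzMap.toLp_fourier_eq] at hF0
  filter_upwards [hq.ae (hW t ht), hq.ae (hW 0 le_rfl), hq.ae hode, hF0,
    (𝓕 V₀ : 𝓢(Space n, State n)).coeFn_toLp 2 (volume : Measure (Space n))]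
    with k hkt hk0 hkode hkF hkS h hdir
  have hsub : direction ((2 * Real.pi) • k) h ∈ tsupport ψ' := by
    refine subset_tsupport _ ?_
    rw [Function.mem_support, hone _ hdir]
    exact one_ne_zero
  have key := hflow _ h hdir (fun s => W s ((2 * Real.pi) • k)) (hkode h hsub) t ht
  simp only [hkt, hk0, inv_smul_smul₀ h2π] at key
  rwa [hkF, hkS, homExt, dif_pos h, hone _ hdir, one_smul] at key

end Multipliers

/-! ### High and low frequency estimates. -/

variable {n : ℕ}

theorem exists_cutoff_bound {ε : ℝ} {χ : ℝ → ℝ} (hχ : Continuous χ)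
    (hχ_zero : ∀ s ≤ ε, χ s = 0) (hχ_one : ∀ s, 2 * ε ≤ s → χ s = 1) :
    ∃ B : ℝ, 1 ≤ B ∧ ∀ s, |χ s| ≤ B := by
  obtain ⟨B, hB⟩ := (isCompact_Icc (a := ε) (b := 2 * ε)).exists_bound_of_continuousOn
    hχ.continuousOn
  refine ⟨max B 1, le_max_right _ _, fun s => ?_⟩
  rcases le_total s ε with h | h
  · rw [hχ_zero s h]; simp
  rcases le_total (2 * ε) s with h' | h'
  · rw [hχ_one s h']; simp
  · exact (hB s ⟨h, h'⟩).trans (le_max_left _ _)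

/-- The multiplier acts on `f`, but the bound is by another function `h`: this lets `V(t)` be
estimated by the data through the pointwise decay. -/
theorem exists_eLpNorm_multiplier_le {p q : ℝ≥0∞} (hp : 1 ≤ p) (hp2 : p ≤ 2) (hq : 2 ≤ q) :
    ∃ C : ℝ, 0 < C ∧ ∀ (m : Space n → ℂ) (B : ℝ) (f h : L2 n) (w : Space n → ℝ),
      Measurable m → (∀ ξ, ‖m ξ‖ ≤ B) → Measurable w →
      (∀ᵐ k, ‖m ((2 * Real.pi) • k)‖ * ‖(𝓕 f : L2 n) k‖ ≤ w k * ‖(𝓕 h : L2 n) k‖) →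
      eLpNorm (multiplier m f) q volume ≤
        ENNReal.ofReal C * eLpNorm w (p⁻¹ - q⁻¹)⁻¹ volume * eLpNorm h p volume := by
  obtain ⟨C, hC, H⟩ := exists_eLpNorm_fourierInv_le (E := Space n) (F := State n) hp hp2 hq
  refine ⟨C, hC, fun m B f h w hm hB hw hle => ?_⟩
  have key := H (𝓕 (multiplier m f)) h w hw (by
    filter_upwards [fourier_multiplier hm hB f, hle] with k h1 h2
    rwa [h1, norm_smul])
  rwa [FourierTransform.fourierInv_fourier_eq] at key

theorem norm_fourier_bessel_apply (s : ℝ) (f : 𝓢(Space n, State n)) (k : Space n) :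
    ‖(𝓕 (SchwartzMap.fourierMultiplierCLM (State n)
      (fun k : Space n => (((1 + ‖(2 * Real.pi) • k‖ ^ 2) ^ (s / 2) : ℝ) : ℂ)) f) :
        𝓢(Space n, State n)) k‖ =
      (1 + ‖(2 * Real.pi) • k‖ ^ 2) ^ (s / 2) * ‖(𝓕 f : 𝓢(Space n, State n)) k‖ := by
  have h1 : (fun k : Space n =>
      (1 + ‖(2 * Real.pi) • k‖ ^ 2) ^ (s / 2)).HasTemperateGrowth :=
    (Function.hasTemperateGrowth_one_add_norm_sq_rpow (Space n) (s / 2)).comp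
      ((2 * Real.pi) • ContinuousLinearMap.id ℝ (Space n)).hasTemperateGrowth
  have h2 : (fun k : Space n =>
      (((1 + ‖(2 * Real.pi) • k‖ ^ 2) ^ (s / 2) : ℝ) : ℂ)).HasTemperateGrowth :=
    Function.HasTemperateGrowth.comp Function.Complex.hasTemperateGrowth_ofReal h1
  rw [SchwartzMap.fourierMultiplierCLM_apply, FourierTransform.fourier_fourierInv_eq,
    SchwartzMap.smulLeftCLM_apply_apply h2, norm_smul (β := State n), Complex.norm_real,
    Real.norm_of_nonneg (by positivity)]

theorem homExt_eq_zero_or {ψ : Sph n → ℂ} (ξ : Space n) :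
    homExt ψ ξ = 0 ∨ ∃ h : ξ ≠ 0, direction ξ h ∈ tsupport ψ := by
  by_cases h : ξ ≠ 0
  · by_cases h0 : ψ (direction ξ h) = 0
    · left; rw [homExt, dif_pos h, h0]
    · exact Or.inr ⟨h, subset_tsupport _ h0⟩
  · left; rw [homExt, dif_neg h]

variable [Fact (3 ≤ n)] {A : ElasticSymbol n} {κ γ : ℝ} {r : Fin n → Sph n → Space n}
  {ψ ψ' : Sph n → ℂ}

/-- The pointwise decay estimate over the directions in the support of `ψ`. -/
def HasSolutionDecay (A : ElasticSymbol n) (κ γ : ℝ) (r : Fin n → Sph n → Space n)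
    (ψ ψ' : Sph n → ℂ) (c : ℝ) : Prop :=
  ∀ (V₀ : 𝓢(Space n, State n)) (V : ℝ → L2 n), IsSolution A κ γ r ψ' V₀ V → ∀ t, 0 ≤ t →
    ∀ᵐ k : Space n, ∀ h : (2 * Real.pi) • k ≠ 0, direction ((2 * Real.pi) • k) h ∈ tsupport ψ →
      ‖(𝓕 (V t) : L2 n) k‖ ≤ 3 * Real.exp (-(c * min 1 (‖(2 * Real.pi) • k‖ ^ 2)) * t) *
        ‖(𝓕 V₀ : 𝓢(Space n, State n)) k‖

/-- On the support of `φ` one has `|ξ| > ε`, so the rate is at least `c min(1, ε²)`. The Bessel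
weight placed on `V₀` is compensated by its inverse in the symbol. -/
theorem high_frequency_estimate {c : ℝ} (hc : 0 < c) (hdec : HasSolutionDecay A κ γ r ψ ψ' c)
    (hψ : Continuous ψ) {ε : ℝ} (hε : 0 < ε) {φ : ℝ → ℂ} (hφ : Continuous φ) {B : ℝ}
    (hB : 0 < B) (hφB : ∀ s, ‖φ s‖ ≤ B) (hφ_zero : ∀ s ≤ ε, φ s = 0)
    {p q : ℝ≥0∞} (hp : 1 ≤ p) (hp2 : p ≤ 2) (hq : 2 ≤ q) {s : ℝ}
    (hs : (n : ℝ) * (p⁻¹ - q⁻¹).toReal < s) :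
    ∃ K : ℝ, 0 < K ∧ ∀ (V₀ : 𝓢(Space n, State n)) (V : ℝ → L2 n),
      IsSolution A κ γ r ψ' V₀ V → ∀ t : ℝ, 0 ≤ t →
        eLpNorm (multiplier (fun ξ => φ ‖ξ‖ * homExt ψ ξ) (V t)) q volume ≤
          ENNReal.ofReal (K * Real.exp (-(c * min 1 (ε ^ 2)) * t)) * sobolevNorm p s V₀ := by
  obtain ⟨C, hC, H⟩ := exists_eLpNorm_multiplier_le (n := n) hp hp2 hq
  obtain ⟨Bψ, hBψ, hψB⟩ := exists_norm_homExt_le hψ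
  set b : Space n → ℝ := fun k => (1 + ‖(2 * Real.pi) • k‖ ^ 2) ^ (-(s / 2)) with hb
  have hbm : Measurable b := by fun_prop
  have hfin : eLpNorm b (p⁻¹ - q⁻¹)⁻¹ volume < ⊤ := by
    refine eLpNorm_bessel_lt_top ?_
    rwa [finrank_euclideanSpace_fin]
  set L : ℝ := (eLpNorm b (p⁻¹ - q⁻¹)⁻¹ volume).toReal with hL
  have hL0 : 0 ≤ L := ENNReal.toReal_nonneg
  -- `L + 1` replaces `L` only to keep the constant positive.
  refine ⟨C * (3 * (B * Bψ)) * (L + 1), by positivity, fun V₀ V hV t ht => ?_⟩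
  set e : ℝ := Real.exp (-(c * min 1 (ε ^ 2)) * t) with he
  have he0 : 0 < e := Real.exp_pos _
  set J := SchwartzMap.fourierMultiplierCLM (State n)
    (fun k : Space n => (((1 + ‖(2 * Real.pi) • k‖ ^ 2) ^ (s / 2) : ℝ) : ℂ)) V₀ with hJ
  have hmB : ∀ ξ : Space n, ‖φ ‖ξ‖ * homExt ψ ξ‖ ≤ B * Bψ := fun ξ => by
    rw [norm_mul]
    exact mul_le_mul (hφB _) (hψB ξ) (norm_nonneg _) hB.le
  have key := H (fun ξ => φ ‖ξ‖ * homExt ψ ξ) (B * Bψ) (V t) (J.toLp 2)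
    ((3 * (B * Bψ) * e) • b)
    ((hφ.measurable.comp measurable_norm).mul (measurable_homExt hψ)) hmB (hbm.const_smul _) (by
      filter_upwards [hdec V₀ V hV t ht,
        (𝓕 J : 𝓢(Space n, State n)).coeFn_toLp 2 (volume : Measure (Space n))] with k h1 h2
      rw [SchwartzMap.toLp_fourier_eq, h2, hJ, norm_fourier_bessel_apply]
      have hcancel : b k * (1 + ‖(2 * Real.pi) • k‖ ^ 2) ^ (s / 2) = 1 := by
        rw [hb, ← Real.rpow_add (by positivity)]; simp
      set v := ‖(𝓕 V₀ : 𝓢(Space n, State n)) k‖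
      have hrhs : ((3 * (B * Bψ) * e) • b) k * ((1 + ‖(2 * Real.pi) • k‖ ^ 2) ^ (s / 2) * v) =
          3 * (B * Bψ) * e * v := by
        rw [Pi.smul_apply, smul_eq_mul]
        linear_combination (3 * (B * Bψ) * e * v) * hcancel
      rw [hrhs]
      have hv : 0 ≤ v := norm_nonneg _
      by_cases hle : ‖(2 * Real.pi) • k‖ ≤ ε
      · rw [hφ_zero _ hle, zero_mul, norm_zero, zero_mul]
        positivity
      rcases homExt_eq_zero_or (ψ := ψ) ((2 * Real.pi) • k) with h0 | ⟨hk, hdir⟩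
      · rw [h0, mul_zero, norm_zero, zero_mul]
        positivity
      push Not at hle
      calc _ ≤ B * Bψ * (3 * e * v) := by
            gcongr
            · exact hmB _
            · refine (h1 hk hdir).trans ?_
              rw [he]
              gcongr
        _ = _ := by ring)
  refine key.trans ?_
  rw [eLpNorm_const_smul, eLpNorm_congr_ae (J.coeFn_toLp 2 (volume : Measure (Space n))),
    sobolevNorm, ← hJ]
  gcongr
  rw [← ENNReal.ofReal_toReal hfin.ne, ← hL, Real.enorm_of_nonneg (by positivity),
    ← ENNReal.ofReal_mul (by positivity), ← ENNReal.ofReal_mul (by positivity)]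
  refine ENNReal.ofReal_le_ofReal ?_
  calc C * (3 * (B * Bψ) * e * L) = C * (3 * (B * Bψ)) * L * e := by ring
    _ ≤ C * (3 * (B * Bψ)) * (L + 1) * e := by gcongr; linarith

theorem low_frequency_estimate {c : ℝ} (hc : 0 < c) (hdec : HasSolutionDecay A κ γ r ψ ψ' c)
    (hψ : Continuous ψ) {R : ℝ} (hR : 0 < R) {φ : ℝ → ℂ} (hφ : Continuous φ) {B : ℝ}
    (hB : 0 < B) (hφB : ∀ s, ‖φ s‖ ≤ B) (hφ_zero : ∀ s, R ≤ s → φ s = 0)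
    {p q : ℝ≥0∞} (hp : 1 ≤ p) (hp2 : p ≤ 2) (hq : 2 ≤ q) :
    ∃ K : ℝ, 0 < K ∧ ∀ (V₀ : 𝓢(Space n, State n)) (V : ℝ → L2 n),
      IsSolution A κ γ r ψ' V₀ V → ∀ t : ℝ, 0 ≤ t →
        eLpNorm (multiplier (fun ξ => φ ‖ξ‖ * homExt ψ ξ) (V t)) q volume ≤
          ENNReal.ofReal (K * (1 + t) ^ (-((n : ℝ) / 2) * (p⁻¹ - q⁻¹).toReal)) *
            eLpNorm V₀ p volume := by
  obtain ⟨C, hC, H⟩ := exists_eLpNorm_multiplier_le (n := n) hp hp2 hq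
  obtain ⟨Bψ, hBψ, hψB⟩ := exists_norm_homExt_le hψ
  -- Chosen so that `m₀ y ≤ min 1 y` for `0 ≤ y ≤ R²`.
  set m₀ : ℝ := min 1 (1 / R ^ 2) with hm₀
  have hm₀0 : 0 < m₀ := by positivity
  have hρ : p⁻¹ - q⁻¹ ≠ ⊤ :=
    (tsub_le_self.trans_lt (by simpa using zero_lt_one.trans_le hp)).ne
  obtain ⟨K, hK, hgauss⟩ := exists_eLpNorm_gaussian_le (E := Space n) hρ
    (b := c * m₀ * (2 * Real.pi) ^ 2) (by positivity)
  -- The factor `exp(c m₀ R²)` pays for replacing `t` by `1 + t` in the Gaussian on `|ξ| ≤ R`.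
  set D : ℝ := 3 * (B * Bψ) * Real.exp (c * m₀ * R ^ 2) with hD
  have hD0 : 0 < D := by positivity
  refine ⟨C * D * K, by positivity, fun V₀ V hV t ht => ?_⟩
  set g : Space n → ℝ := fun k =>
    Real.exp (-(c * m₀ * (2 * Real.pi) ^ 2 * (1 + t)) * ‖k‖ ^ 2) with hg
  have hmB : ∀ ξ : Space n, ‖φ ‖ξ‖ * homExt ψ ξ‖ ≤ B * Bψ := fun ξ => by
    rw [norm_mul]
    exact mul_le_mul (hφB _) (hψB ξ) (norm_nonneg _) hB.le
  have hgm : Measurable g := by fun_prop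
  have key := H (fun ξ => φ ‖ξ‖ * homExt ψ ξ) (B * Bψ) (V t) (V₀.toLp 2) (D • g)
    ((hφ.measurable.comp measurable_norm).mul (measurable_homExt hψ)) hmB (hgm.const_smul _) (by
      filter_upwards [hdec V₀ V hV t ht,
        (𝓕 V₀ : 𝓢(Space n, State n)).coeFn_toLp 2 (volume : Measure (Space n))] with k h1 h2
      rw [SchwartzMap.toLp_fourier_eq, h2, Pi.smul_apply, smul_eq_mul]
      have hg0 : 0 < g k := Real.exp_pos _
      set v := ‖(𝓕 V₀ : 𝓢(Space n, State n)) k‖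
      have hv : 0 ≤ v := norm_nonneg _
      by_cases hle : R ≤ ‖(2 * Real.pi) • k‖
      · rw [hφ_zero _ hle, zero_mul, norm_zero, zero_mul]
        positivity
      rcases homExt_eq_zero_or (ψ := ψ) ((2 * Real.pi) • k) with h0 | ⟨hk, hdir⟩
      · rw [h0, mul_zero, norm_zero, zero_mul]
        positivity
      push Not at hle
      have hexp : Real.exp (-(c * min 1 (‖(2 * Real.pi) • k‖ ^ 2)) * t) ≤
          Real.exp (c * m₀ * R ^ 2) * g k := by
        have hnorm : ‖(2 * Real.pi) • k‖ ^ 2 = (2 * Real.pi) ^ 2 * ‖k‖ ^ 2 := by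
          rw [norm_smul, mul_pow, Real.norm_of_nonneg (by positivity)]
        rw [hg, ← Real.exp_add]
        refine Real.exp_le_exp.2 ?_
        set y := ‖(2 * Real.pi) • k‖ ^ 2 with hy
        have hyR : y ≤ R ^ 2 := by rw [hy]; gcongr
        have hy0 : 0 ≤ y := by positivity
        have hmy : m₀ * y ≤ min 1 y := by
          refine le_min ?_ (mul_le_of_le_one_left hy0 (min_le_left _ _))
          calc m₀ * y ≤ 1 / R ^ 2 * R ^ 2 := by gcongr; exact min_le_right _ _
            _ = 1 := by field_simp
        have e1 : -(c * m₀ * (2 * Real.pi) ^ 2 * (1 + t)) * ‖k‖ ^ 2 =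
            -(c * (m₀ * y) * t) - c * m₀ * y := by rw [hnorm]; ring
        have e2 : c * (m₀ * y) * t ≤ c * min 1 y * t := by gcongr
        have e3 : c * m₀ * y ≤ c * m₀ * R ^ 2 := by gcongr
        simp only [e1]
        linarith
      calc _ ≤ B * Bψ * (3 * (Real.exp (c * m₀ * R ^ 2) * g k) * v) := by
            gcongr
            · exact hmB _
            · refine (h1 hk hdir).trans ?_
              gcongr
        _ = _ := by rw [hD]; ring)
  refine key.trans ?_
  rw [eLpNorm_const_smul, eLpNorm_congr_ae (V₀.coeFn_toLp 2 (volume : Measure (Space n)))]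
  gcongr
  have hgt := hgauss t ht
  rw [finrank_euclideanSpace_fin] at hgt
  calc _ ≤ ENNReal.ofReal C * (‖D‖ₑ * ENNReal.ofReal
        (K * (1 + t) ^ (-((n : ℝ) / 2) * (p⁻¹ - q⁻¹).toReal))) := by gcongr
    _ = _ := by
      rw [Real.enorm_of_nonneg hD0.le, ← ENNReal.ofReal_mul hD0.le, ← ENNReal.ofReal_mul hC.le]
      congr 1
      ring

end ThermoElastic

end

theorem mainTheorem6 {n : ℕ} [Fact (3 ≤ n)] (A : ThermoElastic.ElasticSymbol n)
    (κ γ : ℝ) (hκ : 0 < κ) (hγ : 0 < γ ^ 2)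
    (U : Set (ThermoElastic.Sph n)) (hU : IsOpen U)
    (hU_nondeg : ∀ η ∈ U, ThermoElastic.IsNondegenerate A η)
    (r : Fin n → ThermoElastic.Sph n → ThermoElastic.Space n)
    (hr : ThermoElastic.IsEigenframe A U r)
    (ψ ψ' : ThermoElastic.Sph n → ℂ)
    (hψ : ContMDiff (𝓡 (n - 1)) 𝓘(ℝ, ℂ) ∞ ψ) (hψ' : ContMDiff (𝓡 (n - 1)) 𝓘(ℝ, ℂ) ∞ ψ')
    (hψU : tsupport ψ ⊆ U) (hψ'U : tsupport ψ' ⊆ U)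
    (hψ'_one : ∀ η ∈ tsupport ψ, ψ' η = 1)
    (hψ_parabolic : ∀ η ∈ tsupport ψ, ThermoElastic.IsParabolic A r η)
    (ε : ℝ) (hε : 0 < ε) (χ : ℝ → ℝ) (hχ : ContDiff ℝ ∞ χ)
    (hχ_zero : ∀ s ≤ ε, χ s = 0) (hχ_one : ∀ s, 2 * ε ≤ s → χ s = 1) :
    ∃ c : ℝ, 0 < c ∧ ∀ p q : ℝ≥0∞, 1 ≤ p → p ≤ 2 → 2 ≤ q →
      (∀ s : ℝ, (n : ℝ) * (p⁻¹.toReal - q⁻¹.toReal) < s →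
        ∃ K : ℝ, 0 < K ∧
          ∀ (V₀ : 𝓢(ThermoElastic.Space n, ThermoElastic.State n))
            (V : ℝ → ThermoElastic.L2 n),
            ThermoElastic.IsSolution A κ γ r ψ' V₀ V → ∀ t : ℝ, 0 ≤ t →
              eLpNorm (ThermoElastic.multiplier
                  (fun ξ => (χ ‖ξ‖ : ℂ) * ThermoElastic.homExt ψ ξ) (V t)) q volume ≤
                ENNReal.ofReal (K * Real.exp (-c * t)) * ThermoElastic.sobolevNorm p s V₀) ∧
      (∃ K : ℝ, 0 < K ∧
        ∀ (V₀ : 𝓢(ThermoElastic.Space n, ThermoElastic.State n))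
          (V : ℝ → ThermoElastic.L2 n),
          ThermoElastic.IsSolution A κ γ r ψ' V₀ V → ∀ t : ℝ, 0 ≤ t →
            eLpNorm (ThermoElastic.multiplier
                (fun ξ => (1 - (χ ‖ξ‖ : ℂ)) * ThermoElastic.homExt ψ ξ) (V t)) q volume ≤
              ENNReal.ofReal
                  (K * (1 + t) ^ (-((n : ℝ) / 2) * (p⁻¹.toReal - q⁻¹.toReal))) *
                eLpNorm V₀ p volume) := by
  have hγ0 : γ ≠ 0 := by
    rintro rfl
    simp at hγ
  obtain ⟨c, hc, hdec⟩ := ThermoElastic.exists_solution_decay hκ hγ0 hr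
    (isClosed_tsupport ψ).isCompact hψU hψ_parabolic hψ'.continuous hψ'_one
  obtain ⟨B, hB, hχB⟩ := ThermoElastic.exists_cutoff_bound hχ.continuous hχ_zero hχ_one
  have hχc : Continuous fun s => (χ s : ℂ) := Complex.continuous_ofReal.comp hχ.continuous
  refine ⟨c * min 1 (ε ^ 2), by positivity, fun p q hp hp2 hq => ?_⟩
  have hpq : p⁻¹.toReal - q⁻¹.toReal = (p⁻¹ - q⁻¹).toReal := by
    rw [ENNReal.toReal_sub_of_le (ENNReal.inv_le_inv.2 (hp2.trans hq))]
    simpa using (zero_lt_one.trans_le hp).ne'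
  rw [hpq]
  refine ⟨fun s hs => ?_, ?_⟩
  · exact ThermoElastic.high_frequency_estimate hc hdec hψ.continuous hε hχc
      (zero_lt_one.trans_le hB) (fun s => by rw [Complex.norm_real]; exact hχB s)
      (fun s hs => by rw [hχ_zero s hs, Complex.ofReal_zero]) hp hp2 hq hs
  · exact ThermoElastic.low_frequency_estimate hc hdec hψ.continuous
      (φ := fun s => 1 - (χ s : ℂ)) (B := 1 + B) (by positivity : 0 < 2 * ε)
      (continuous_const.sub hχc) (by positivity)
      (fun s => (norm_sub_le _ _).trans (by
        rw [norm_one, Complex.norm_real]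
        exact add_le_add_right (hχB s) 1))
      (fun s hs => by rw [hχ_one s hs, Complex.ofReal_one, sub_self]) hp hp2 hq
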